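/- All graphs have a finite vertex set $V$, no loops, directed edges $D$ and bidirected edges $B$; $|G|=|D|+|B|$. A graph is ancestral if it has no directed cycle and no directed path between the endpoints of a bidirected edge. On a path, an interior vertex is a collider if both path edges at it have an arrowhead at it. A path is m-connecting given $C$ if each interior collider is an ancestor of some element of $C$ (every vertex being an ancestor of itself) and no interior non-collider lies in $C$; disjoint sets $A,B$ are m-separated given $C$ (disjoint from $A$ and $B$) if no m-connecting path given $C$ joins an element of $A$ to an element of $B$. Two graphs are Markov equivalent if they have the same m-separation relations. An ancestral graph is maximal, and is then called a DMAG, if any two distinct non-adjacent vertices $i,j$ are m-separated given some $S\subseteq V\setminus\{i,j\}$. The maximal closure $\overline G$ of an ancestral graph $G$ is the DMAG that contains all edges of $G$ and has the same m-separation relations as $G$. Let $\mathbb P$ be the joint distribution of a random vector $X=(X_v)_{v\in V}$ whose components take values in standard Borel spaces. $\mathbb P$ is restricted-faithful to a DMAG $G$ if it is Markov to $G$ (for disjoint $A,B,C$, if $A,B$ are m-separated given $C$ then $X_A$ and $X_B$ are conditionally independent given $X_C$) and, for all distinct $i,j\in V$ and all $S\subseteq V\setminus\{i,j\}$, the variables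 $X_i$ and $X_j$ are not conditionally independent given $X_S$ in each of these cases: (1) $i$ and $j$ are adjacent in $G$; (2) $i,j$ have a common neighbour $k$ in the skeleton of $G$, and $i,j$ are not m-separated given $S$; (3) there is a discriminating path $\langle i,\dots,k,j\rangle$ in $G$, and $i,j$ are not m-separated given $S$. Here a path $\langle i,\dots,k,j\rangle$ is discriminating if $i,j$ are not adjacent, there is at least one vertex between $i$ and $k$, and each such vertex is a collider on the path and a parent of $j$. For a partial order $\pi$ on $V$, let $\mathrm{AG}(\pi,\mathbb P)$ be the ancestral graph in which distinct $i,j$ are adjacent if and only if $X_i$ and $X_j$ are not conditionally independent given the $X_x$ with $x\in\{x: x\le_\pi i\text{ or }x\le_\pi j\}\setminus\{i,j\}$, the edge being $i\to j$ if $i\le_\pi j$ and $i\leftrightarrow j$ if $i,j$ are incomparable. For an ancestral graph $G$, let $\mathrm{po}(G)$ be the partial order on $V$ in which $i\le j$ if and only if $i$ is an ancestor of $j$ in $G$. Put $G_\pi=\overline{\mathrm{AG}(\mathrm{po}(\mathrm{AG}(\pi,\mathbb P)),\mathbb P)}$. **Theorem (Sparsest Poset).** Let $\mathbb P$ be restricted-faithful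 to a DMAG $G^*$ on $V$. If $\tau$ is a partial order on $V$ with $|G_\tau|\le|G_\pi|$ for all partial orders $\pi$ on $V$, then $G_\tau$ is Markov equivalent to $G^*$. -/

import Mathlib

/-- A loopless graph on `V` with directed edges `i → j` (`D i j`) and bidirected edges
`i ↔ j` (`B i j`). -/
@[ext]
structure MixedGraph (V : Type*) where
  D : V → V → Prop
  B : V → V → Prop
  D_irrefl : ∀ i, ¬ D i i
  B_irrefl : ∀ i, ¬ B i i
  B_symm : ∀ i j, B i j → B j i

namespace MixedGraph

variable {V : Type*}

/-- The skeleton: all edges are replaced by undirected ones. -/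
def skel (G : MixedGraph V) : SimpleGraph V where
  Adj i j := G.D i j ∨ G.D j i ∨ G.B i j
  symm := ⟨fun i j h => by
    rcases h with h | h | h
    · exact Or.inr (Or.inl h)
    · exact Or.inl h
    · exact Or.inr (Or.inr (G.B_symm i j h))⟩
  loopless := ⟨fun i h => by
    rcases h with h | h | h
    · exact G.D_irrefl i h
    · exact G.D_irrefl i h
    · exact G.B_irrefl i h⟩

/-- The number of edges `|D| + |B|`, every bidirected edge being counted once. -/
noncomputable def numEdges (G : MixedGraph V) : ℕ :=
  {p : V × V | G.D p.1 p.2}.ncard + {e : Sym2 V | ∃ i j, e = s(i, j) ∧ G.B i j}.ncard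

/-- `i` is an ancestor of `j`: there is a directed path, possibly of length zero, from `i` to
`j`. -/
def Anc (G : MixedGraph V) (i j : V) : Prop := Relation.ReflTransGen G.D i j

/-- No directed cycles, and no directed path between the endpoints of a bidirected edge. -/
structure IsAncestral (G : MixedGraph V) : Prop where
  acyclic : ∀ i, ¬ Relation.TransGen G.D i i
  no_dirPath : ∀ i j, G.B i j → ¬ Relation.TransGen G.D i j

/-- There is an edge between `i` and `k` with an arrowhead at `k`. -/
def Into (G : MixedGraph V) (i k : V) : Prop := G.D i k ∨ G.B i k

/-- `k` is a collider between its neighbours `i` and `j` on a path. -/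
def Collider (G : MixedGraph V) (i k j : V) : Prop := G.Into i k ∧ G.Into j k

/-- A path is m-connecting given `C` if every interior vertex that is a collider on it is an
ancestor of a member of `C`, and every interior vertex that is not a collider on it is outside `C`.
(In an ancestral graph there is at most one edge between two vertices, so that a path is determined
by its sequence of vertices.) -/
def MConnecting (G : MixedGraph V) {i j : V} (p : G.skel.Walk i j) (C : Set V) : Prop :=
  p.IsPath ∧ ∀ m, m + 2 ≤ p.length →
    (G.Collider (p.getVert m) (p.getVert (m + 1)) (p.getVert (m + 2)) →
      ∃ c ∈ C, G.Anc (p.getVert (m + 1)) c) ∧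
    (¬ G.Collider (p.getVert m) (p.getVert (m + 1)) (p.getVert (m + 2)) →
      p.getVert (m + 1) ∉ C)

/-- `A` and `B` are m-separated given `C`. -/
def MSep (G : MixedGraph V) (A B C : Set V) : Prop :=
  ∀ i ∈ A, ∀ j ∈ B, ∀ p : G.skel.Walk i j, ¬ G.MConnecting p C

/-- Maximality: non-adjacent vertices can be m-separated. -/
def IsMaximal (G : MixedGraph V) : Prop :=
  ∀ i j, i ≠ j → ¬ G.skel.Adj i j → ∃ S : Set V, i ∉ S ∧ j ∉ S ∧ G.MSep {i} {j} S

/-- Directed maximal ancestral graphs. -/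
structure IsDMAG (G : MixedGraph V) : Prop where
  ancestral : G.IsAncestral
  maximal : G.IsMaximal

/-- Two graphs are Markov equivalent if they have the same m-separation relations. -/
def MarkovEquiv (G H : MixedGraph V) : Prop :=
  ∀ A B C : Set V, Disjoint A B → Disjoint A C → Disjoint B C →
    (G.MSep A B C ↔ H.MSep A B C)

/-- `H` is the maximal closure of `G`: a maximal ancestral graph that contains all edges of `G`
and has the same m-separation relations. -/
structure IsMaximalClosure (G H : MixedGraph V) : Prop where
  dmag : H.IsDMAG
  directed_subset : ∀ i j, G.D i j → H.D i j
  bidirected_subset : ∀ i j, G.B i j → H.B i j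
  markovEquiv : H.MarkovEquiv G

/-- `p = ⟨i, …, k, j⟩` is a discriminating path for its last but one vertex `k`: its endpoints are
not adjacent, there is at least one vertex between `i` and `k`, and every such vertex is a collider
on the path and a parent of `j`. -/
def Discriminating (G : MixedGraph V) {i j : V} (p : G.skel.Walk i j) : Prop :=
  p.IsPath ∧ ¬ G.skel.Adj i j ∧ 3 ≤ p.length ∧
    ∀ m, m + 3 ≤ p.length →
      G.Collider (p.getVert m) (p.getVert (m + 1)) (p.getVert (m + 2)) ∧
        G.D (p.getVert (m + 1)) j

/-- The poset of a directed ancestral graph: `i ≤ j` if and only if `i` is an ancestor of `j`. -/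
@[reducible]
def po (G : MixedGraph V) (hG : G.IsAncestral) : PartialOrder V where
  le := G.Anc
  lt i j := G.Anc i j ∧ ¬ G.Anc j i
  le_refl _ := Relation.ReflTransGen.refl
  le_trans _ _ _ := Relation.ReflTransGen.trans
  lt_iff_le_not_ge _ _ := Iff.rfl
  le_antisymm i j hij hji := by
    rcases Relation.reflTransGen_iff_eq_or_transGen.1 hij with h | h
    · exact h.symm
    · exact absurd (Relation.TransGen.trans_left h hji) (hG.acyclic i)

end MixedGraph

/-- The elements that lie below `i` or below `j` in the poset `π`, other than `i` and `j`. -/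
def preSep {V : Type*} (π : PartialOrder V) (i j : V) : Set V :=
  {x | π.le x i ∨ π.le x j} \ {i, j}

theorem preSep_comm {V : Type*} (π : PartialOrder V) (i j : V) : preSep π i j = preSep π j i := by
  ext x
  simp only [preSep, Set.mem_sdiff, Set.mem_ofPred_eq, Set.mem_insert_iff, Set.mem_singleton_iff]
  tauto

section Distribution

open MeasureTheory ProbabilityTheory

variable {V : Type*} [Finite V] {𝓧 : V → Type*} [∀ v, MeasurableSpace (𝓧 v)]
  [∀ v, StandardBorelSpace (𝓧 v)]

/-- `X_A` and `X_B` are conditionally independent given `X_C`, where `X` is the random vector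
`(X_v : v ∈ V)` with joint distribution `P`. -/
def CI (P : Measure (∀ v, 𝓧 v)) [IsProbabilityMeasure P] (A B C : Set V) : Prop :=
  CondIndepFun (MeasurableSpace.comap (C.domRestrict (π := 𝓧)) inferInstance)
    (Set.measurable_restrict C).comap_le (A.domRestrict (π := 𝓧)) (B.domRestrict (π := 𝓧)) P

theorem CI.symm {P : Measure (∀ v, 𝓧 v)} [IsProbabilityMeasure P] {A B C : Set V}
    (h : CI P A B C) : CI P B A C :=
  CondIndepFun.symm h

/-- `P` is Markov with respect to `G`: every m-separation is a conditional independence. -/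
def IsMarkov (P : Measure (∀ v, 𝓧 v)) [IsProbabilityMeasure P] (G : MixedGraph V) : Prop :=
  ∀ A B C : Set V, Disjoint A B → Disjoint A C → Disjoint B C → G.MSep A B C → CI P A B C

/-- Restricted faithfulness of `P` to `G`: the Markov property together with adjacency-,
orientation- and discriminating-faithfulness. -/
structure RestrictedFaithful (P : Measure (∀ v, 𝓧 v)) [IsProbabilityMeasure P]
    (G : MixedGraph V) : Prop where
  markov : IsMarkov P G
  adjacency : ∀ i j, G.skel.Adj i j → ∀ S : Set V, i ∉ S → j ∉ S → ¬ CI P {i} {j} S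
  orientation : ∀ i k j, i ≠ j → G.skel.Adj i k → G.skel.Adj k j →
    ∀ S : Set V, i ∉ S → j ∉ S → ¬ G.MSep {i} {j} S → ¬ CI P {i} {j} S
  discriminating : ∀ (i j : V) (p : G.skel.Walk i j), G.Discriminating p →
    ∀ S : Set V, i ∉ S → j ∉ S → ¬ G.MSep {i} {j} S → ¬ CI P {i} {j} S

/-- The graph `AG(π, P)`. -/
def AG (P : Measure (∀ v, 𝓧 v)) [IsProbabilityMeasure P] (π : PartialOrder V) :
    MixedGraph V where
  D i j := i ≠ j ∧ π.le i j ∧ ¬ CI P {i} {j} (preSep π i j)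
  B i j := ¬ π.le i j ∧ ¬ π.le j i ∧ ¬ CI P {i} {j} (preSep π i j)
  D_irrefl _ h := h.1 rfl
  B_irrefl i h := h.1 (π.le_refl i)
  B_symm i j h := ⟨h.2.1, h.1, fun hc => h.2.2 (by rw [preSep_comm]; exact hc.symm)⟩

theorem AG_transGen (P : Measure (∀ v, 𝓧 v)) [IsProbabilityMeasure P] (π : PartialOrder V)
    {i j : V} (h : Relation.TransGen (AG P π).D i j) : π.le i j ∧ i ≠ j := by
  induction h with
  | single h => exact ⟨h.2.1, h.1⟩
  | tail _ h ih =>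
    refine ⟨π.le_trans _ _ _ ih.1 h.2.1, ?_⟩
    rintro rfl
    exact h.1 (π.le_antisymm _ _ h.2.1 ih.1)

theorem AG_isAncestral (P : Measure (∀ v, 𝓧 v)) [IsProbabilityMeasure P] (π : PartialOrder V) :
    (AG P π).IsAncestral where
  acyclic _ h := (AG_transGen P π h).2 rfl
  no_dirPath _ _ hB h := hB.1 (AG_transGen P π h).1

/-- `H` is the graph `G_π`: the maximal closure of `AG(po(AG(π, P)), P)`. -/
def IsPosetGraph (P : Measure (∀ v, 𝓧 v)) [IsProbabilityMeasure P] (π : PartialOrder V)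
    (H : MixedGraph V) : Prop :=
  (AG P ((AG P π).po (AG_isAncestral P π))).IsMaximalClosure H

end Distribution

/-!
Let `σ` be the ancestral order of `AG P τ`. By adjacency-faithfulness the skeleton of every graph
`AG P π` contains that of `Gstar`, and the ancestral order of `Gstar` yields `Gstar` itself. Hence
minimality forces `Gτ` to have the skeleton of `Gstar` and to be equal to `AG P σ`, that is, to this
skeleton oriented by `σ`. If `i` and `j` are the endpoints of an unshielded triple or of a
discriminating path of `Gstar`, then restricted faithfulness turns the independence that is
responsible for their non-adjacency in `Gτ` into a separation in `Gstar` by the elements below `i`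
or `j` in `σ` (`MixedGraph.Oriented`). Such a separating set contains all colliders of the
discriminating path, and it contains the discriminated vertex if and only if that is no collider
(`MixedGraph.Seg.mem`, `MixedGraph.Seg.mem_iff`).

These local facts are spread to all separations by means of connecting walks that are shortest and,
among those, closest to the conditioning set (`MixedGraph.MinConn`). On such a walk each interior
vertex is the middle of an unshielded triple or is discriminated by a part of the walk, and the same
holds with the first step of a shortest directed path from a collider to the conditioning set
(`MixedGraph.MinConn.seg_or_seg`, `MixedGraph.MinConn.seg_or_seg_of_closer`).

The argument then has three steps. A vertex of a minimal connecting walk that is `σ`-maximal among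
those not below `y` in `τ` leads to a contradiction, so that `AG P τ` has no arrow `x → y` besides
those of `Gτ`, and `σ` is the ancestral order of `Gτ` (`MixedGraph.Oriented.not_mConn_of_le`). Now a
minimal connecting walk of `Gstar` has the same colliders in `Gτ`, as a further collider would make
a discriminating path inducing in the maximal graph `Gτ` (`MixedGraph.Oriented.mConn`). Conversely,
since separation in `Gτ` implies separation in `Gstar`, a minimal connecting walk of `Gτ` can have a
collider that is none in `Gstar` only if it is discriminated through another such collider; these
vertices cannot all look in one direction along the walk, and where the directions meet there is
again an inducing walk (`MixedGraph.Refines.mConn_symm`).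
-/


namespace MixedGraph

variable {V : Type*} {G : MixedGraph V}

/-! ### Marks in ancestral graphs -/

theorem Into.adj {u v : V} (h : G.Into u v) : G.skel.Adj u v :=
  h.elim Or.inl fun h => Or.inr (Or.inr h)

theorem Collider.symm {u k w : V} (h : G.Collider u k w) : G.Collider w k u := ⟨h.2, h.1⟩

theorem collider_comm {u k w : V} : G.Collider u k w ↔ G.Collider w k u := and_comm

namespace IsAncestral

theorem not_d_symm (hG : G.IsAncestral) {u v : V} (h : G.D u v) : ¬ G.D v u := fun h' =>
  hG.acyclic u (.tail (.single h) h')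

theorem not_into_of_transGen (hG : G.IsAncestral) {u v : V} (h : Relation.TransGen G.D u v) :
    ¬ G.Into v u := by
  rintro (h' | h')
  · exact hG.acyclic u (h.tail h')
  · exact hG.no_dirPath u v (G.B_symm _ _ h') h

theorem not_into_of_d (hG : G.IsAncestral) {u v : V} (h : G.D u v) : ¬ G.Into v u :=
  hG.not_into_of_transGen (.single h)

theorem d_of_not_into {u v : V} (h : G.skel.Adj u v) (h' : ¬ G.Into u v) : G.D v u := by
  rcases h with h | h | h
  · exact absurd (Or.inl h) h'
  · exact h
  · exact absurd (Or.inr h) h'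

theorem into_of_not_d {u v : V} (h : G.skel.Adj u v) (h' : ¬ G.D v u) : G.Into u v := by
  by_contra h2
  exact h' (d_of_not_into h h2)

theorem d_trans (hG : G.IsAncestral) {u v w : V} (h : G.D u v) (h' : G.D v w)
    (ha : G.skel.Adj u w) : G.D u w :=
  d_of_not_into ha.symm (hG.not_into_of_transGen (.tail (.single h) h'))

/-- In an ancestral graph an arrowhead is passed on: `u *→ v → w` gives `u *→ w`. -/
theorem into_trans (hG : G.IsAncestral) {u v w : V} (h : G.Into u v) (h' : G.D v w)
    (ha : G.skel.Adj u w) : G.Into u w := by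
  refine into_of_not_d ha fun h2 => ?_
  exact hG.not_into_of_transGen (.tail (.single h') h2) h

theorem ne_of_into_d (hG : G.IsAncestral) {u v w : V} (h : G.Into u v) (h' : G.D v w) :
    u ≠ w := by
  rintro rfl
  exact hG.not_into_of_d h' h

theorem not_anc_of_into (hG : G.IsAncestral) {u v : V} (h : G.Into u v) : ¬ G.Anc v u := by
  intro h'
  rcases Relation.reflTransGen_iff_eq_or_transGen.1 h' with h2 | h2
  · exact G.skel.loopless.irrefl _ (h2 ▸ h.adj)
  · exact hG.not_into_of_transGen h2 h

end IsAncestral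

/-! ### Connecting walks -/

/-- The condition that m-connection given `C` puts on an interior vertex `k` between `u` and
`w`. -/
def Open (G : MixedGraph V) (C : Set V) (u k w : V) : Prop :=
  (G.Collider u k w → ∃ c ∈ C, G.Anc k c) ∧ (¬ G.Collider u k w → k ∉ C)

/-- The sequence `p 0, …, p n` is a walk all of whose interior vertices are open given `C`. In
contrast to `MConnecting`, vertices may be repeated; the values of `p` beyond `n` are irrelevant. -/
structure Conn (G : MixedGraph V) (C : Set V) (n : ℕ) (p : ℕ → V) : Prop where
  adj : ∀ m < n, G.skel.Adj (p m) (p (m + 1))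
  isOpen : ∀ m, m + 2 ≤ n → G.Open C (p m) (p (m + 1)) (p (m + 2))

/-- Some walk from `a` to `b` is connecting given `C`. -/
def MConn (G : MixedGraph V) (C : Set V) (a b : V) : Prop :=
  ∃ n p, p 0 = a ∧ p n = b ∧ G.Conn C n p

variable {C : Set V} {n : ℕ} {p : ℕ → V}

theorem Open.symm {u k w : V} (h : G.Open C u k w) : G.Open C w k u :=
  ⟨fun h' => h.1 h'.symm, fun h' => h.2 fun h2 => h' h2.symm⟩

theorem Open.congr {u k w u' w' : V} (h : G.Open C u k w) (hu : G.Into u k ↔ G.Into u' k)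
    (hw : G.Into w k ↔ G.Into w' k) : G.Open C u' k w' := by
  unfold Open Collider at *
  rwa [← hu, ← hw]

theorem Conn.reverse (h : G.Conn C n p) : G.Conn C n (fun m => p (n - m)) where
  adj m hm := by
    have := (h.adj (n - (m + 1)) (by omega)).symm
    rwa [show n - (m + 1) + 1 = n - m by omega] at this
  isOpen m hm := by
    have := (h.isOpen (n - (m + 2)) (by omega)).symm
    rwa [show n - (m + 2) + 1 = n - (m + 1) by omega,
      show n - (m + 2) + 2 = n - m by omega] at this

theorem MConn.symm {a b : V} (h : G.MConn C a b) : G.MConn C b a := by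
  obtain ⟨n, p, rfl, rfl, h⟩ := h
  exact ⟨n, _, by simp, by simp, h.reverse⟩

theorem Conn.mono (h : G.Conn C n p) {k : ℕ} (hk : k ≤ n) : G.Conn C k p :=
  ⟨fun m hm => h.adj m (by omega), fun m hm => h.isOpen m (by omega)⟩

/-- A connecting walk can be prolonged by an edge. -/
theorem Conn.snoc (h : G.Conn C n p) {w : V} (ha : G.skel.Adj (p n) w)
    (ho : 0 < n → G.Open C (p (n - 1)) (p n) w) :
    G.Conn C (n + 1) (fun m => if m ≤ n then p m else w) where
  adj m hm := by
    rcases Nat.lt_or_ge m n with h1 | h1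
    · simpa [h1.le, Nat.succ_le_of_lt h1] using h.adj m h1
    · obtain rfl : m = n := by omega
      simpa using ha
  isOpen m hm := by
    rcases Nat.lt_or_ge (m + 1) n with h1 | h1
    · have := h.isOpen m h1
      simp only [show m ≤ n by omega, show m + 1 ≤ n by omega, show m + 2 ≤ n by omega, if_true]
      exact this
    · obtain rfl : n = m + 1 := by omega
      simpa using ho (by omega)

/-- The part of `p` strictly between positions `s` and `t` is replaced by an edge. -/
theorem Conn.shortcut (h : G.Conn C n p) {s t : ℕ} (hst : s < t) (ht : t ≤ n)
    (ha : G.skel.Adj (p s) (p t)) (hs : 0 < s → G.Open C (p (s - 1)) (p s) (p t))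
    (ht' : t < n → G.Open C (p s) (p t) (p (t + 1))) :
    ∃ q, q 0 = p 0 ∧ q (n - (t - s - 1)) = p n ∧ G.Conn C (n - (t - s - 1)) q := by
  refine ⟨fun m => if m ≤ s then p m else p (m + (t - s - 1)), by simp, ?_, ?_, ?_⟩
  · beta_reduce
    rw [if_neg (by omega)]
    congr 1; omega
  · intro m hm
    rcases lt_trichotomy m s with h1 | h1 | h1
    · simpa [h1.le, Nat.succ_le_of_lt h1] using h.adj m (by omega)
    · subst h1
      simpa [show m + 1 + (t - m - 1) = t by omega] using ha
    · have := h.adj (m + (t - s - 1)) (by omega)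
      simpa [show ¬ m ≤ s by omega, show ¬ m + 1 ≤ s by omega,
        show m + 1 + (t - s - 1) = m + (t - s - 1) + 1 by omega] using this
  · intro m hm
    rcases lt_trichotomy (m + 1) s with h1 | h1 | h1
    · have := h.isOpen m (by omega)
      simpa [show m ≤ s by omega, show m + 1 ≤ s by omega, show m + 2 ≤ s by omega] using this
    · subst h1
      simpa [show m + 2 + (t - (m + 1) - 1) = t by omega] using hs (by omega)
    · rcases (show m = s ∨ s < m by omega) with rfl | h2
      · have := ht' (by omega)
        simpa [show m + 1 + (t - m - 1) = t by omega,
          show m + 2 + (t - m - 1) = t + 1 by omega] using this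
      · have := h.isOpen (m + (t - s - 1)) (by omega)
        simpa [show ¬ m ≤ s by omega, show ¬ m + 1 ≤ s by omega, show ¬ m + 2 ≤ s by omega,
          show m + 1 + (t - s - 1) = m + (t - s - 1) + 1 by omega,
          show m + 2 + (t - s - 1) = m + (t - s - 1) + 2 by omega] using this

/-- The part of `p` strictly between positions `s` and `t` is replaced by a single vertex `d`. -/
theorem Conn.detour (h : G.Conn C n p) {s t : ℕ} (hst : s + 2 ≤ t) (ht : t ≤ n) {d : V}
    (ha : G.skel.Adj (p s) d) (ha' : G.skel.Adj d (p t)) (hd : G.Open C (p s) d (p t))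
    (hs : 0 < s → G.Open C (p (s - 1)) (p s) d)
    (ht' : t < n → G.Open C d (p t) (p (t + 1))) :
    G.Conn C (n - (t - s - 2))
      (fun m => if m ≤ s then p m else if m = s + 1 then d else p (m + (t - s - 2))) := by
  refine ⟨?_, ?_⟩
  · intro m hm
    rcases lt_trichotomy m s with h1 | h1 | h1
    · simpa [h1.le, Nat.succ_le_of_lt h1] using h.adj m (by omega)
    · subst h1
      simpa using ha
    · rcases (show m = s + 1 ∨ s + 1 < m by omega) with rfl | h2
      · simpa [show s + 1 + 1 + (t - s - 2) = t by omega] using ha'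
      · have := h.adj (m + (t - s - 2)) (by omega)
        simpa [show ¬ m ≤ s by omega, show ¬ m + 1 ≤ s by omega, show m ≠ s + 1 by omega,
          show m ≠ s by omega,
          show m + 1 + (t - s - 2) = m + (t - s - 2) + 1 by omega] using this
  · intro m hm
    rcases lt_trichotomy (m + 1) s with h1 | h1 | h1
    · have := h.isOpen m (by omega)
      simpa [show m ≤ s by omega, show m + 1 ≤ s by omega, show m + 2 ≤ s by omega] using this
    · subst h1
      simpa using hs (by omega)
    · rcases (show m = s ∨ m = s + 1 ∨ s + 1 < m by omega) with rfl | rfl | h2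
      · simpa [show m + 2 + (t - m - 2) = t by omega] using hd
      · have := ht' (by omega)
        simpa [show ¬ s + 1 + 2 ≤ s by omega, show s + 1 + 1 + (t - s - 2) = t by omega,
          show s + 1 + 2 + (t - s - 2) = t + 1 by omega] using this
      · have := h.isOpen (m + (t - s - 2)) (by omega)
        simpa [show ¬ m ≤ s by omega, show ¬ m + 1 ≤ s by omega, show ¬ m + 2 ≤ s by omega,
          show m ≠ s + 1 by omega, show m ≠ s by omega, show m + 1 ≠ s by omega,
          show m + 1 + (t - s - 2) = m + (t - s - 2) + 1 by omega,
          show m + 2 + (t - s - 2) = m + (t - s - 2) + 2 by omega] using this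

/-- A connecting walk that leaves `p s` along a directed edge is either directed up to `p t`, or
meets a collider on its way, so that `p s` is an ancestor of `C`. -/
theorem Conn.anc_or_transGen (h : G.Conn C n p) {s t : ℕ} (hd : G.D (p s) (p (s + 1)))
    (hst : s < t) (ht : t ≤ n) :
    (∃ c ∈ C, G.Anc (p s) c) ∨ Relation.TransGen G.D (p s) (p t) ∧ G.D (p (t - 1)) (p t) := by
  induction t, hst using Nat.le_induction with
  | base => exact Or.inr ⟨.single hd, hd⟩
  | succ t hst ih =>
    rcases ih (by omega) with h1 | ⟨h1, h2⟩
    · exact Or.inl h1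
    · by_cases h3 : G.Into (p (t + 1)) (p t)
      · have ho := h.isOpen (t - 1) (by omega)
        rw [show t - 1 + 1 = t by omega, show t - 1 + 2 = t + 1 by omega] at ho
        obtain ⟨c, hc, hc'⟩ := ho.1 ⟨Or.inl h2, h3⟩
        exact Or.inl ⟨c, hc, h1.to_reflTransGen.trans hc'⟩
      · have h4 := IsAncestral.d_of_not_into (h.adj t (by omega)).symm h3
        exact Or.inr ⟨h1.tail h4, h4⟩

/-- A repeated vertex can be cut out of a connecting walk. -/
theorem Conn.exists_shorter (h : G.Conn C n p) (hG : G.IsAncestral) (hab : p 0 ≠ p n) {s t : ℕ}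
    (hst : s < t) (ht : t ≤ n) (heq : p s = p t) :
    ∃ k < n, ∃ q, q 0 = p 0 ∧ q k = p n ∧ G.Conn C k q := by
  rcases ht.eq_or_lt with rfl | htn
  · exact ⟨s, hst, p, rfl, heq, h.mono hst.le⟩
  obtain ⟨q, h1, h2, h3⟩ := h.shortcut (s := s) (t := t + 1) (by omega) htn
    (heq ▸ h.adj t htn) (fun hs => by
      have o1 := h.isOpen (s - 1) (by omega)
      rw [show s - 1 + 1 = s by omega, show s - 1 + 2 = s + 1 by omega] at o1
      have o2 := h.isOpen (t - 1) (by omega)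
      rw [show t - 1 + 1 = t by omega, show t - 1 + 2 = t + 1 by omega, ← heq] at o2
      refine ⟨fun hc => ?_, fun hc hC => ?_⟩
      · by_cases h4 : G.Into (p (s + 1)) (p s)
        · exact o1.1 ⟨hc.1, h4⟩
        · have h5 := IsAncestral.d_of_not_into (h.adj s (by omega)).symm h4
          rcases h.anc_or_transGen h5 hst ht with h6 | h6
          · exact h6
          · exact absurd (heq ▸ h6.1) (hG.acyclic _)
      · have h4 : G.Collider (p (s - 1)) (p s) (p (s + 1)) := by
          by_contra h5; exact o1.2 h5 hC
        have h6 : G.Collider (p (t - 1)) (p s) (p (t + 1)) := by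
          by_contra h5; exact o2.2 h5 hC
        exact hc ⟨h4.1, h6.2⟩)
    (fun h4 => by
      have := h.isOpen t (by omega)
      rwa [← heq] at this)
  exact ⟨_, by omega, q, h1, h2, h3⟩

theorem skel_walk_of_adj (h : ∀ m < n, G.skel.Adj (p m) (p (m + 1))) :
    ∃ q : G.skel.Walk (p 0) (p n), q.length = n ∧ ∀ m ≤ n, q.getVert m = p m := by
  induction n generalizing p with
  | zero => exact ⟨.nil, rfl, fun m hm => by obtain rfl : m = 0 := by omega
                                             simp⟩
  | succ n ih =>
    obtain ⟨q, hq, hq'⟩ := ih (p := fun m => p (m + 1)) (fun m hm => h (m + 1) (by omega))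
    refine ⟨.cons (h 0 (by omega)) q, by simp [hq], fun m hm => ?_⟩
    rcases m with _ | m
    · simp
    · rw [SimpleGraph.Walk.getVert_cons_succ]
      exact hq' m (by omega)

theorem skel_path_of_adj (h : ∀ m < n, G.skel.Adj (p m) (p (m + 1)))
    (hi : ∀ s t, s < t → t ≤ n → p s ≠ p t) :
    ∃ q : G.skel.Walk (p 0) (p n), q.IsPath ∧ q.length = n ∧ ∀ m ≤ n, q.getVert m = p m := by
  obtain ⟨q, hq, hq'⟩ := skel_walk_of_adj h
  refine ⟨q, ?_, hq, hq'⟩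
  rw [← SimpleGraph.Walk.IsPath.getVert_injOn_iff]
  intro s hs t ht heq
  simp only [Set.mem_ofPred_eq, hq] at hs ht
  rw [hq' s hs, hq' t ht] at heq
  rcases lt_trichotomy s t with h1 | h1 | h1
  · exact absurd heq (hi _ _ h1 ht)
  · exact h1
  · exact absurd heq.symm (hi _ _ h1 hs)

/-- In an ancestral graph the walk version of m-connection agrees with the path version. -/
theorem not_mSep_iff (hG : G.IsAncestral) {a b : V} (hab : a ≠ b) :
    ¬ G.MSep {a} {b} C ↔ G.MConn C a b := by
  constructor
  · intro h
    simp only [MSep, Set.mem_singleton_iff, forall_eq, not_forall, not_not] at h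
    obtain ⟨p, hp⟩ := h
    exact ⟨p.length, p.getVert, by simp, by simp, fun m hm => p.adj_getVert_succ hm, hp.2⟩
  · rintro ⟨n, h⟩ hsep
    induction n using Nat.strong_induction_on with
    | _ n ih =>
      obtain ⟨p, rfl, rfl, h⟩ := h
      by_cases hi : ∀ s t, s < t → t ≤ n → p s ≠ p t
      · obtain ⟨q, hq, hq', hq''⟩ := skel_path_of_adj h.adj hi
        refine hsep _ rfl _ rfl q ⟨hq, fun m hm => ?_⟩
        rw [hq' ] at hm
        rw [hq'' m (by omega), hq'' (m + 1) (by omega), hq'' (m + 2) hm]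
        exact h.isOpen m hm
      · push Not at hi
        obtain ⟨s, t, hst, ht, heq⟩ := hi
        obtain ⟨k, hk, q, h1, h2, h3⟩ := h.exists_shorter hG hab hst ht heq
        exact ih k hk ⟨q, h1, h2, h3⟩

/-! ### Inducing walks -/

/-- A directed path from `k` to `j` outside `C` prolongs a connecting walk that enters `k`. -/
theorem Conn.append_dir (h : G.Conn C n p) {j : V} (hC : ¬ ∃ c ∈ C, G.Anc (p n) c)
    (hG : G.IsAncestral) (hj : G.Anc (p n) j) : G.MConn C (p 0) j := by
  have key : ∀ v, G.Anc (p n) v → ∃ n' q, q 0 = p 0 ∧ q n' = v ∧ G.Conn C n' q := by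
    intro v hv
    induction hv with
    | refl => exact ⟨n, p, rfl, rfl, h⟩
    | @tail v w hv hw ih =>
      obtain ⟨n', q, h1, h2, h3⟩ := ih
      refine ⟨n' + 1, _, ?_, ?_, h3.snoc (w := w) (h2 ▸ Or.inl hw) fun _ => ?_⟩
      · simpa using h1
      · simp
      · rw [h2]
        exact ⟨fun hc => absurd hc.2 (hG.not_into_of_d hw), fun _ hvC => hC ⟨v, hvC, hv⟩⟩
  exact key j hj

/-- The reversed directed path from `k` to its descendant `i`, outside `C`, followed by an edge at
`k`, is connecting. -/
theorem exists_conn_of_anc {i k w : V} (hG : G.IsAncestral) (hC : ¬ ∃ c ∈ C, G.Anc k c)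
    (hi : G.Anc k i) (hkw : G.skel.Adj k w) :
    ∃ n p, p 0 = i ∧ p n = k ∧ p (n + 1) = w ∧ G.Conn C (n + 1) p := by
  have key : ∀ v, G.Anc k v → ∃ n p, p 0 = v ∧ p n = k ∧ p (n + 1) = w ∧
      G.Conn C (n + 1) p := by
    intro v hv
    induction hv with
    | refl =>
      refine ⟨0, fun m => if m = 0 then k else w, by simp, by simp, by simp, ⟨?_, ?_⟩⟩
      · intro m hm
        obtain rfl : m = 0 := by omega
        simpa using hkw
      · intro m hm; omega
    | @tail v x hv hx ih =>
      obtain ⟨n, p, h1, h2, h3, h4⟩ := ih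
      refine ⟨n + 1, fun m => if m = 0 then x else p (m - 1), by simp, by simpa, by simpa,
        ⟨?_, ?_⟩⟩
      · intro m hm
        rcases m with _ | m
        · simpa [h1] using (show G.skel.Adj x v from Or.inr (Or.inl hx))
        · simpa using h4.adj m (by omega)
      · intro m hm
        rcases m with _ | m
        · simp only [if_true, Nat.zero_add, one_ne_zero, if_false, Nat.sub_self, h1]
          exact ⟨fun hc => absurd hc.1 (hG.not_into_of_d hx), fun _ hvC => hC ⟨v, hvC, hv⟩⟩
        · simpa using h4.isOpen m (by omega)
  exact key i hi

/-- The endpoints of a walk whose interior vertices are colliders and ancestors of the endpoints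
are connected given any set. At a vertex that is not an ancestor of `C` the walk is left or entered
through a directed path to an endpoint, which avoids `C`. -/
theorem mConn_of_inducing (hG : G.IsAncestral) (hn : 0 < n)
    (ha : ∀ m < n, G.skel.Adj (p m) (p (m + 1)))
    (hc : ∀ m, m + 2 ≤ n → G.Collider (p m) (p (m + 1)) (p (m + 2)) ∧
      (G.Anc (p (m + 1)) (p 0) ∨ G.Anc (p (m + 1)) (p n))) (C : Set V) :
    G.MConn C (p 0) (p n) := by
  have key : ∀ m, m < n → G.MConn C (p 0) (p n) ∨
      ∃ k q, q 0 = p 0 ∧ q k = p m ∧ q (k + 1) = p (m + 1) ∧ G.Conn C (k + 1) q := by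
    intro m
    induction m with
    | zero =>
      intro _
      exact Or.inr ⟨0, p, rfl, rfl, rfl, fun m hm => ha m (by omega), fun m hm => by omega⟩
    | succ m ih =>
      intro hm
      rcases ih (by omega) with h | ⟨k, q, h1, h2, h3, h4⟩
      · exact Or.inl h
      by_cases hC : ∃ c ∈ C, G.Anc (p (m + 1)) c
      · refine Or.inr ⟨k + 1, _, ?_, ?_, ?_, h4.snoc (w := p (m + 2)) ?_ fun _ => ?_⟩
        · simpa using h1
        · simpa using h3
        · simp
        · rw [h3]; exact ha _ hm
        · rw [h3, Nat.add_sub_cancel, h2]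
          exact ⟨fun _ => hC, fun h => absurd (hc m (by omega)).1 h⟩
      · rcases (hc m (by omega)).2 with h5 | h5
        · obtain ⟨k, q, h6, h7, h8, h9⟩ := exists_conn_of_anc hG hC h5 (ha _ hm)
          exact Or.inr ⟨k, q, h6, h7, h8, h9⟩
        · left
          rw [← h1]
          exact h4.append_dir (h3 ▸ hC) hG (h3 ▸ h5)
  rcases key (n - 1) (by omega) with h | ⟨k, q, h1, h2, h3, h4⟩
  · exact h
  · exact ⟨k + 1, q, h1, by rw [h3]; congr 1; omega, h4⟩

/-- In a maximal ancestral graph, the endpoints of an inducing walk are adjacent. -/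
theorem IsDMAG.adj_of_inducing (hG : G.IsDMAG) (hn : 0 < n) (hne : p 0 ≠ p n)
    (ha : ∀ m < n, G.skel.Adj (p m) (p (m + 1)))
    (hc : ∀ m, m + 2 ≤ n → G.Collider (p m) (p (m + 1)) (p (m + 2)) ∧
      (G.Anc (p (m + 1)) (p 0) ∨ G.Anc (p (m + 1)) (p n))) :
    G.skel.Adj (p 0) (p n) := by
  by_contra h
  obtain ⟨S, -, -, hS⟩ := hG.maximal _ _ hne h
  exact (not_mSep_iff hG.ancestral hne).2 (mConn_of_inducing hG.ancestral hn ha hc S) hS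

/-- Every vertex of a walk that is connecting given `C` is an ancestor of an endpoint or of `C`. -/
theorem Conn.anc (h : G.Conn C n p) {m : ℕ} (hm : m ≤ n) :
    G.Anc (p m) (p 0) ∨ G.Anc (p m) (p n) ∨ ∃ c ∈ C, G.Anc (p m) c := by
  rcases Nat.eq_zero_or_pos m with rfl | h0
  · exact Or.inl .refl
  rcases hm.eq_or_lt with rfl | h1
  · exact Or.inr (Or.inl .refl)
  have ho := h.isOpen (m - 1) (by omega)
  rw [show m - 1 + 1 = m by omega, show m - 1 + 2 = m + 1 by omega] at ho
  by_cases h2 : G.Into (p (m + 1)) (p m)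
  · by_cases h3 : G.Into (p (m - 1)) (p m)
    · exact Or.inr (Or.inr (ho.1 ⟨h3, h2⟩))
    · have h4 := h.reverse
      have h5 : G.D (p m) (p (m - 1)) := by
        refine IsAncestral.d_of_not_into ?_ h3
        have := h.adj (m - 1) (by omega)
        rwa [show m - 1 + 1 = m by omega] at this
      have := h4.anc_or_transGen (s := n - m) (t := n)
        (by simpa [show n - (n - m) = m by omega, show n - (n - m + 1) = m - 1 by omega]
              using h5) (by omega) le_rfl
      rcases this with h6 | h6
      · rw [show n - (n - m) = m by omega] at h6
        exact Or.inr (Or.inr h6)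
      · have h7 := h6.1
        rw [show n - (n - m) = m by omega, Nat.sub_self] at h7
        exact Or.inl h7.to_reflTransGen
  · have h4 := IsAncestral.d_of_not_into (h.adj m h1).symm h2
    rcases h.anc_or_transGen h4 h1 le_rfl with h6 | h6
    · exact Or.inr (Or.inr h6)
    · exact Or.inr (Or.inl h6.1.to_reflTransGen)

/-! ### Minimal connecting walks -/

/-- The vertices from which a directed path of length `k` leads to `C`. -/
def reach (G : MixedGraph V) (C : Set V) : ℕ → Set V
  | 0 => C
  | k + 1 => {v | ∃ w, G.D v w ∧ w ∈ G.reach C k}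

/-- The length of a shortest directed path from `v` to `C`; it is `0` if there is none. -/
noncomputable def distTo (G : MixedGraph V) (C : Set V) (v : V) : ℕ := sInf {k | v ∈ G.reach C k}

theorem exists_mem_reach {v : V} (h : ∃ c ∈ C, G.Anc v c) : ∃ k, v ∈ G.reach C k := by
  obtain ⟨c, hc, h⟩ := h
  induction h using Relation.ReflTransGen.head_induction_on with
  | refl => exact ⟨0, hc⟩
  | head h _ ih =>
    obtain ⟨k, hk⟩ := ih
    exact ⟨k + 1, _, h, hk⟩

theorem anc_of_mem_reach {k : ℕ} {v : V} (h : v ∈ G.reach C k) : ∃ c ∈ C, G.Anc v c := by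
  induction k generalizing v with
  | zero => exact ⟨v, h, .refl⟩
  | succ k ih =>
    obtain ⟨w, hw, h⟩ := h
    obtain ⟨c, hc, h⟩ := ih h
    exact ⟨c, hc, .head hw h⟩

/-- The first step on a shortest directed path to `C`. -/
theorem exists_closer {v : V} (h : ∃ c ∈ C, G.Anc v c) (hv : v ∉ C) :
    ∃ d, G.D v d ∧ (∃ c ∈ C, G.Anc d c) ∧ G.distTo C d + 1 = G.distTo C v := by
  have h1 : v ∈ G.reach C (G.distTo C v) := Nat.sInf_mem (s := {k | v ∈ G.reach C k})
    (exists_mem_reach h)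
  obtain ⟨k, hk⟩ : ∃ k, G.distTo C v = k + 1 := by
    refine Nat.exists_eq_succ_of_ne_zero fun h0 => hv ?_
    rw [h0] at h1
    exact h1
  rw [hk] at h1
  obtain ⟨d, hd, h2⟩ := h1
  refine ⟨d, hd, anc_of_mem_reach h2, ?_⟩
  have h3 : G.distTo C d ≤ k := Nat.sInf_le h2
  have h4 : d ∈ G.reach C (G.distTo C d) := Nat.sInf_mem (s := {k | d ∈ G.reach C k}) ⟨k, h2⟩
  have h5 : G.distTo C v ≤ G.distTo C d + 1 := Nat.sInf_le ⟨d, hd, h4⟩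
  omega

theorem distTo_le_of_d {v d : V} (h : G.D v d) (hd : ∃ c ∈ C, G.Anc d c) :
    G.distTo C v ≤ G.distTo C d + 1 :=
  Nat.sInf_le ⟨d, h, Nat.sInf_mem (s := {k | d ∈ G.reach C k}) (exists_mem_reach hd)⟩

/-- A connecting walk between two distinct vertices that is shortest and, among the shortest ones,
has the least sum of distances of its vertices to the conditioning set. -/
structure MinConn (G : MixedGraph V) (C : Set V) (n : ℕ) (p : ℕ → V) : Prop where
  conn : G.Conn C n p
  ne : p 0 ≠ p n
  length_le : ∀ k q, q 0 = p 0 → q k = p n → G.Conn C k q → n ≤ k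
  dist_le : ∀ q, q 0 = p 0 → q n = p n → G.Conn C n q →
    ∑ m ∈ Finset.range (n + 1), G.distTo C (p m) ≤ ∑ m ∈ Finset.range (n + 1), G.distTo C (q m)

theorem MConn.exists_minConn {a b : V} (h : G.MConn C a b) (hab : a ≠ b) :
    ∃ n p, p 0 = a ∧ p n = b ∧ G.MinConn C n p := by
  classical
  have h' : ∃ n, ∃ p, p 0 = a ∧ p n = b ∧ G.Conn C n p := h
  set n := Nat.find h' with hn
  have h2 : ∃ s, ∃ p, (p 0 = a ∧ p n = b ∧ G.Conn C n p) ∧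
      ∑ m ∈ Finset.range (n + 1), G.distTo C (p m) = s := by
    obtain ⟨p, hp⟩ := Nat.find_spec h'
    exact ⟨_, p, hp, rfl⟩
  obtain ⟨p, ⟨h3, h4, h5⟩, h6⟩ := Nat.find_spec h2
  refine ⟨n, p, h3, h4, h5, h3 ▸ h4 ▸ hab, fun k q hq hq' hk => ?_, fun q hq hq' hk => ?_⟩
  · exact Nat.find_min' h' ⟨q, hq.trans h3, hq'.trans h4, hk⟩
  · rw [h6]
    exact Nat.find_min' h2 ⟨q, ⟨hq.trans h3, hq'.trans h4, hk⟩, rfl⟩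

theorem sum_range_reflect_succ (f : ℕ → ℕ) (n : ℕ) :
    ∑ m ∈ Finset.range (n + 1), f (n - m) = ∑ m ∈ Finset.range (n + 1), f m := by
  simpa using Finset.sum_range_reflect f (n + 1)

/-- `p (l + 1), …, p (m - 1)` are colliders on `p` and parents of `w`, and `p l` is not adjacent to
`w`. Thus `⟨p l, …, p m, w⟩` is an unshielded triple if `l + 1 = m`, and otherwise a discriminating
path for `p m`. -/
structure Seg (G : MixedGraph V) (p : ℕ → V) (l m : ℕ) (w : V) : Prop where
  lt : l < m
  adj : ∀ y, l ≤ y → y < m → G.skel.Adj (p y) (p (y + 1))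
  adj_last : G.skel.Adj (p m) w
  coll : ∀ y, l < y → y < m → G.Collider (p (y - 1)) (p y) (p (y + 1)) ∧ G.D (p y) w
  not_adj : ¬ G.skel.Adj (p l) w
  inj : ∀ s t, l ≤ s → s < t → t ≤ m → p s ≠ p t
  ne : p l ≠ w

/-- Scanning `p` to the left from a vertex with `p l₀ *→ p (l₀ + 1) → w`, one passes colliders that
are parents of `w` until one meets a vertex that is not adjacent to `w`, or a vertex whose edge to
`w` can replace its edge on `p`. -/
theorem Conn.exists_scan (h : G.Conn C n p) (hG : G.IsAncestral) {l₀ : ℕ} {w : V} (hl : l₀ < n)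
    (hi : G.Into (p l₀) (p (l₀ + 1))) (hd : G.D (p (l₀ + 1)) w) :
    ∃ l ≤ l₀, (∀ y, l < y → y ≤ l₀ → G.Collider (p (y - 1)) (p y) (p (y + 1)) ∧ G.D (p y) w) ∧
      p l ≠ w ∧ (¬ G.skel.Adj (p l) w ∨
        G.Into (p l) w ∧ (0 < l → G.Open C (p (l - 1)) (p l) w)) := by
  induction l₀ with
  | zero =>
    refine ⟨0, le_rfl, fun y hy hy' => by omega, hG.ne_of_into_d hi hd, ?_⟩
    by_cases ha : G.skel.Adj (p 0) w
    · exact Or.inr ⟨hG.into_trans hi hd ha, fun h => absurd h (lt_irrefl _)⟩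
    · exact Or.inl ha
  | succ l₀ ih =>
    by_cases ha : G.skel.Adj (p (l₀ + 1)) w
    swap
    · exact ⟨l₀ + 1, le_rfl, fun y hy hy' => by omega, hG.ne_of_into_d hi hd, Or.inl ha⟩
    by_cases hc : G.Collider (p l₀) (p (l₀ + 1)) (p (l₀ + 2)) ∧ G.D (p (l₀ + 1)) w
    · obtain ⟨l, hl', h1, h2⟩ := ih (by omega) hc.1.1 hc.2
      refine ⟨l, by omega, fun y hy hy' => ?_, h2⟩
      rcases hy'.eq_or_lt with rfl | h3
      · exact hc
      · exact h1 y hy (by omega)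
    · refine ⟨l₀ + 1, le_rfl, fun y hy hy' => by omega, hG.ne_of_into_d hi hd,
        Or.inr ⟨hG.into_trans hi hd ha, fun _ => ?_⟩⟩
      rw [Nat.add_sub_cancel]
      have ho := h.isOpen l₀ (by omega)
      by_cases hw : G.Into w (p (l₀ + 1))
      · have h1 : G.Into (p (l₀ + 2)) (p (l₀ + 1)) := by
          refine IsAncestral.into_of_not_d hi.adj.symm fun h2 => ?_
          exact hG.not_into_of_d (hG.d_trans h2 hd ha) hw
        exact ho.congr Iff.rfl (iff_of_true h1 hw)
      · have h1 := IsAncestral.d_of_not_into ha.symm hw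
        exact ⟨fun h2 => absurd h2.2 hw, fun _ => ho.2 fun h2 => hc ⟨h2, h1⟩⟩

/-- If replacing the two edges at `k` by an edge between `u` and `w` spoils the vertex `u`, then
`u` is a collider and a parent of `w`. -/
theorem collider_of_not_open (hG : G.IsAncestral) {x u k w : V} (huk : G.skel.Adj u k)
    (hkw : G.skel.Adj k w) (huw : G.skel.Adj u w) (hu : G.Open C x u k) (hk : G.Open C u k w)
    (h : ¬ G.Open C x u w) : G.Collider x u k ∧ G.D u w := by
  by_cases h1 : G.Into k u
  · by_cases h2 : G.Into w u
    · exact absurd (hu.congr Iff.rfl (iff_of_true h1 h2)) h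
    · refine ⟨?_, IsAncestral.d_of_not_into huw.symm h2⟩
      by_contra h3
      exact h ⟨fun h4 => absurd h4.2 h2, fun _ => hu.2 h3⟩
  · have h2 := IsAncestral.d_of_not_into huk.symm h1
    refine absurd ⟨fun h3 => ?_, fun _ => hu.2 fun h4 => h1 h4.2⟩ h
    obtain ⟨c, hc, h4⟩ := hk.1 ⟨Or.inl h2, hG.into_trans h3.2 h2 hkw.symm⟩
    exact ⟨c, hc, .head h2 h4⟩

namespace MinConn

theorem inj (h : G.MinConn C n p) (hG : G.IsAncestral) {s t : ℕ} (hst : s < t) (ht : t ≤ n) :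
    p s ≠ p t := by
  intro heq
  obtain ⟨k, hk, q, h1, h2, h3⟩ := h.conn.exists_shorter hG h.ne hst ht heq
  exact absurd (h.length_le k q h1 h2 h3) (by omega)

theorem reverse (h : G.MinConn C n p) : G.MinConn C n (fun m => p (n - m)) where
  conn := h.conn.reverse
  ne := by simpa using h.ne.symm
  length_le k q h1 h2 hq := by
    refine h.length_le k _ ?_ ?_ hq.reverse
    · simpa using h2
    · simpa using h1
  dist_le q h1 h2 hq := by
    have := h.dist_le _ (by simpa using h2) (by simpa using h1) hq.reverse
    rw [sum_range_reflect_succ (fun m => G.distTo C (p m))]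
    rwa [sum_range_reflect_succ (fun m => G.distTo C (q m))] at this

theorem not_shortcut (h : G.MinConn C n p) {s t : ℕ} (hst : s + 1 < t) (ht : t ≤ n)
    (ha : G.skel.Adj (p s) (p t)) (hs : 0 < s → G.Open C (p (s - 1)) (p s) (p t))
    (ht' : t < n → G.Open C (p s) (p t) (p (t + 1))) : False := by
  obtain ⟨q, h1, h2, h3⟩ := h.conn.shortcut (by omega) ht ha hs ht'
  exact absurd (h.length_le _ q h1 h2 h3) (by omega)

/-- If the left neighbour of `p m` is a collider and a parent of the right neighbour, then `p m` is
discriminated by a part of the walk to its left: otherwise the scan would find a shortcut. -/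
theorem exists_seg (h : G.MinConn C n p) (hG : G.IsAncestral) {m : ℕ} (hm : 1 < m) (hmn : m < n)
    (hc : G.Collider (p (m - 2)) (p (m - 1)) (p m)) (hd : G.D (p (m - 1)) (p (m + 1))) :
    ∃ l, G.Seg p l m (p (m + 1)) := by
  obtain ⟨l, hl, h1, h2, h3⟩ := h.conn.exists_scan hG (l₀ := m - 2) (w := p (m + 1)) (by omega)
    (by rw [show m - 2 + 1 = m - 1 by omega]; exact hc.1)
    (by rw [show m - 2 + 1 = m - 1 by omega]; exact hd)
  have hc' : ∀ y, l < y → y < m →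
      G.Collider (p (y - 1)) (p y) (p (y + 1)) ∧ G.D (p y) (p (m + 1)) := by
    intro y hy hy'
    rcases (show y = m - 1 ∨ y ≤ m - 2 by omega) with rfl | h4
    · rw [show m - 1 - 1 = m - 2 by omega, show m - 1 + 1 = m by omega]
      exact ⟨hc, hd⟩
    · exact h1 y hy h4
  rcases h3 with h3 | ⟨h3, h4⟩
  · exact ⟨l, by omega, fun y _ hy => h.conn.adj y (by omega), h.conn.adj m hmn, hc', h3,
      fun s t _ hst ht => h.inj hG hst (by omega), h2⟩
  · refine (h.not_shortcut (s := l) (t := m + 1) (by omega) hmn h3.adj h4 fun h5 => ?_).elim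
    exact (h.conn.isOpen m (by omega)).congr
      (iff_of_true (hG.into_trans hc.2 hd (h.conn.adj m hmn)) h3) Iff.rfl

/-- Every interior vertex of a minimal connecting walk is unshielded or discriminated by a part of
the walk, which may lie on either side of it. -/
theorem seg_or_seg (h : G.MinConn C n p) (hG : G.IsAncestral) {m : ℕ} (hm : 0 < m)
    (hmn : m < n) : (∃ l, G.Seg p l m (p (m + 1))) ∨
      ∃ l, G.Seg (fun x => p (n - x)) l (n - m) (p (m - 1)) := by
  by_contra! hcon
  obtain ⟨hl, hr⟩ := hcon
  have ha : G.skel.Adj (p (m - 1)) (p (m + 1)) := by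
    by_contra ha
    refine hl (m - 1) ⟨by omega, fun y _ hy => h.conn.adj y (by omega), h.conn.adj m hmn,
      fun y hy hy' => by omega, ha, fun s t _ hst ht => h.inj hG hst (by omega), ?_⟩
    exact h.inj hG (by omega) hmn
  have a1 := h.conn.adj (m - 1) (by omega)
  have a2 := h.conn.adj m hmn
  have o1 := h.conn.isOpen (m - 1) (by omega)
  rw [show m - 1 + 1 = m by omega] at a1 o1
  rw [show m - 1 + 2 = m + 1 by omega] at o1
  refine h.not_shortcut (s := m - 1) (t := m + 1) (by omega) hmn ha (fun h0 => ?_) fun h0 => ?_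
  · by_contra h1
    have o2 := h.conn.isOpen (m - 2) (by omega)
    rw [show m - 2 + 1 = m - 1 by omega, show m - 2 + 2 = m by omega] at o2
    rw [show m - 1 - 1 = m - 2 by omega] at h1
    obtain ⟨h2, h3⟩ := collider_of_not_open hG a1 a2 ha o2 o1 h1
    obtain ⟨l, h4⟩ := h.exists_seg hG (by omega) hmn h2 h3
    exact hl l h4
  · by_contra h1
    have o2 := h.conn.isOpen m (by omega)
    obtain ⟨h2, h3⟩ := collider_of_not_open hG a2.symm a1.symm ha.symm o2.symm o1.symm
      fun h2 => h1 h2.symm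
    have h4 := h.reverse.exists_seg hG (m := n - m) (by omega) (by omega)
    simp only [show n - (n - m - 2) = m + 2 by omega, show n - (n - m - 1) = m + 1 by omega,
      show n - (n - m) = m by omega, show n - (n - m + 1) = m - 1 by omega] at h4
    obtain ⟨l, h4⟩ := h4 h2 h3
    exact hr l h4

/-- If a child `d` of a collider `p m` is closer to the conditioning set than `p m`, then a part of
the walk together with `d` is unshielded or discriminating for `p m`. -/
theorem seg_or_seg_of_closer (h : G.MinConn C n p) (hG : G.IsAncestral) {m : ℕ} (hm : 0 < m)
    (hmn : m < n) (hc : G.Collider (p (m - 1)) (p m) (p (m + 1))) {d : V} (hd : G.D (p m) d)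
    (hC : ∃ c ∈ C, G.Anc d c) (hlt : G.distTo C d < G.distTo C (p m)) :
    (∃ l, G.Seg p l m d) ∨ ∃ l, G.Seg (fun x => p (n - x)) l (n - m) d := by
  have left : ∀ q : ℕ → V, G.MinConn C n q → ∀ k, 0 < k → k < n → q k = p m →
      G.Into (q (k - 1)) (q k) →
      (∃ l, G.Seg q l k d) ∨ ∃ l < k, G.Into (q l) d ∧
        (0 < l → G.Open C (q (l - 1)) (q l) d) := by
    intro q hq k hk hkn hqk hi
    obtain ⟨l, hl, h1, h2, h3⟩ := hq.conn.exists_scan hG (l₀ := k - 1) (w := d) (by omega)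
      (by rw [show k - 1 + 1 = k by omega]; exact hi)
      (by rw [show k - 1 + 1 = k by omega, hqk]; exact hd)
    rcases h3 with h3 | ⟨h3, h4⟩
    · exact Or.inl ⟨l, by omega, fun y _ hy => hq.conn.adj y (by omega),
        hqk ▸ Or.inl hd, fun y hy hy' => h1 y hy (by omega), h3,
        fun s t _ hst ht => hq.inj hG hst (by omega), h2⟩
    · exact Or.inr ⟨l, by omega, h3, h4⟩
  rcases left p h m hm hmn rfl hc.1 with h1 | ⟨l, hl, h1, h2⟩
  · exact Or.inl h1
  have h3 := left _ h.reverse (n - m) (by omega) (by omega)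
  simp only [show n - (n - m) = m by omega, show n - (n - m - 1) = m + 1 by omega] at h3
  rcases h3 trivial hc.2 with h3 | ⟨r, hr, h3, h4⟩
  · exact Or.inr h3
  exfalso
  have h5 := h.conn.detour (s := l) (t := n - r) (d := d) (by omega) (by omega) h1.adj
    h3.adj.symm ⟨fun _ => hC, fun h => absurd ⟨h1, h3⟩ h⟩ h2 (fun h6 => by
      have := (h4 (by omega)).symm
      rwa [show n - (r - 1) = n - r + 1 by omega] at this)
  have h6 := h.length_le _ _ (by simp) ?_ h5
  swap
  · rw [if_neg (by omega), if_neg (by omega)]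
    congr 1; omega
  obtain rfl : l = m - 1 := by omega
  obtain rfl : r = n - m - 1 := by omega
  rw [show n - (n - (n - m - 1) - (m - 1) - 2) = n by omega,
    show n - (n - m - 1) - (m - 1) - 2 = 0 by omega] at h5
  have h7 := h.dist_le _ (by simp) (by
    rw [if_neg (by omega), if_neg (by omega)]
    rfl) h5
  refine absurd h7 (not_le.2 (Finset.sum_lt_sum (fun x _ => ?_) ⟨m, by simp; omega, ?_⟩))
  · by_cases hx : x = m
    · subst hx
      rw [if_neg (by omega), if_pos (by omega)]
      exact hlt.le
    · by_cases hx' : x ≤ m - 1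
      · rw [if_pos hx']
      · rw [if_neg hx', if_neg (by omega)]
        rfl
  · rw [if_neg (by omega), if_pos (by omega)]
    exact hlt

end MinConn

/-- Non-adjacent vertices of a maximal ancestral graph are separated by their ancestors. -/
theorem IsDMAG.not_mConn_preSep (hG : G.IsDMAG) {i j : V} (hij : i ≠ j)
    (h : ¬ G.skel.Adj i j) : ¬ G.MConn (preSep (G.po hG.ancestral) i j) i j := by
  intro hc
  obtain ⟨n, p, rfl, rfl, hp⟩ := hc.exists_minConn hij
  refine h (hG.adj_of_inducing (n := n) ?_ hij hp.conn.adj fun m hm => ?_)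
  · rcases Nat.eq_zero_or_pos n with rfl | h0
    · exact absurd rfl hij
    · exact h0
  · have h1 : G.Anc (p (m + 1)) (p 0) ∨ G.Anc (p (m + 1)) (p n) := by
      rcases hp.conn.anc (m := m + 1) (by omega) with h1 | h1 | ⟨c, ⟨hc, -⟩, h1⟩
      · exact Or.inl h1
      · exact Or.inr h1
      · exact hc.imp (h1.trans ·) (h1.trans ·)
    refine ⟨?_, h1⟩
    by_contra h2
    refine (hp.conn.isOpen m hm).2 h2 ⟨h1, ?_⟩
    rintro (h3 | h3)
    · exact hp.inj hG.ancestral (s := 0) (t := m + 1) (by omega) (by omega) h3.symm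
    · exact hp.inj hG.ancestral (s := m + 1) (t := n) (by omega) le_rfl h3

variable {H : MixedGraph V} {S : Set V} {l m : ℕ} {w : V}

/-! ### Separating sets and discriminating paths -/

/-- If the interior vertices of `p l, …, p m, w` before `p m` are colliders in `S`, and `S`
separates `p l` from `w`, then `S` decides whether `p m` is a collider. -/
theorem mem_iff_not_collider (hlm : l < m)
    (ha : ∀ y, l ≤ y → y < m → G.skel.Adj (p y) (p (y + 1))) (hw : G.skel.Adj (p m) w)
    (hc : ∀ y, l < y → y < m → G.Collider (p (y - 1)) (p y) (p (y + 1)) ∧ p y ∈ S)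
    (hS : ¬ G.MConn S (p l) w) : p m ∈ S ↔ ¬ G.Collider (p (m - 1)) (p m) w := by
  by_contra hcon
  have ho : G.Open S (p (m - 1)) (p m) w := by
    by_cases h1 : G.Collider (p (m - 1)) (p m) w
    · refine ⟨fun _ => ⟨p m, ?_, .refl⟩, fun h => absurd h1 h⟩
      by_contra h2
      exact hcon (iff_of_false h2 (not_not.2 h1))
    · exact ⟨fun h => absurd h h1, fun _ h2 => hcon (iff_of_true h2 h1)⟩
  have h1 : G.Conn S (m - l) (fun x => p (x + l)) := by
    refine ⟨fun x hx => ?_, fun x hx => ?_⟩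
    · have := ha (x + l) (by omega) (by omega)
      rwa [show x + l + 1 = x + 1 + l by omega] at this
    · have := hc (x + 1 + l) (by omega) (by omega)
      rw [show x + 1 + l - 1 = x + l by omega, show x + 1 + l + 1 = x + 2 + l by omega] at this
      exact ⟨fun _ => ⟨_, this.2, .refl⟩, fun h => absurd this.1 h⟩
  refine hS ⟨_, _, ?_, ?_, h1.snoc (w := w) ?_ fun _ => ?_⟩
  · simp
  · simp
  · rwa [show m - l + l = m by omega]
  · rwa [show m - l + l = m by omega, show m - l - 1 + l = m - 1 by omega]

namespace Seg

theorem mem (h : G.Seg p l m w) (hG : G.IsAncestral) (hS : ¬ G.MConn S (p l) w) {y : ℕ}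
    (hy : l < y) (hym : y < m) : p y ∈ S := by
  induction y using Nat.strong_induction_on with
  | _ y ih =>
    refine (mem_iff_not_collider hy (fun x hx hx' => h.adj x hx (by omega))
      (Or.inl (h.coll y hy hym).2) (fun x hx hx' => ?_) hS).2 fun hc => ?_
    · exact ⟨(h.coll x hx (by omega)).1, ih x hx' hx (by omega)⟩
    · exact hG.not_into_of_d (h.coll y hy hym).2 hc.2

theorem mem_iff (h : G.Seg p l m w) (hG : G.IsAncestral) (hS : ¬ G.MConn S (p l) w) :
    p m ∈ S ↔ ¬ G.Collider (p (m - 1)) (p m) w :=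
  mem_iff_not_collider h.lt h.adj h.adj_last
    (fun _ hy hy' => ⟨(h.coll _ hy hy').1, h.mem hG hS hy hy'⟩) hS

end Seg

theorem seg_of_unshielded {u k w : V} (huk : G.skel.Adj u k) (hkw : G.skel.Adj k w)
    (huw : ¬ G.skel.Adj u w) (hne : u ≠ w) : G.Seg (fun x => if x = 0 then u else k) 0 1 w where
  lt := one_pos
  adj y _ hy := by
    obtain rfl : y = 0 := by omega
    simpa using huk
  adj_last := by simpa using hkw
  coll y hy hy' := by omega
  not_adj := by simpa using huw
  inj s t _ hst ht := by
    obtain rfl : s = 0 := by omega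
    obtain rfl : t = 1 := by omega
    simpa using huk.ne
  ne := by simpa using hne

/-- The ancestors of the conditioning set survive in `H` along shortest directed paths of `G`, as
these are unshielded. -/
theorem exists_anc_of_closer (hG : G.IsAncestral)
    (hu : ∀ u k w, G.D u k → G.D k w → ¬ G.skel.Adj u w → u ≠ w → H.D u k → H.D k w) :
    ∀ {v d : V}, G.D v d → H.D v d → (∃ c ∈ C, G.Anc d c) → G.distTo C d + 1 = G.distTo C v →
      ∃ c ∈ C, H.Anc v c := by
  suffices h : ∀ k v d, G.distTo C d = k → G.D v d → H.D v d → (∃ c ∈ C, G.Anc d c) →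
      G.distTo C d + 1 = G.distTo C v → ∃ c ∈ C, H.Anc v c from fun {v d} => h _ v d rfl
  intro k
  induction k with
  | zero =>
    intro v d hk h1 h2 h3 h4
    by_cases hd : d ∈ C
    · exact ⟨d, hd, .single h2⟩
    · obtain ⟨e, _, _, h5⟩ := exists_closer h3 hd
      omega
  | succ k ih =>
    intro v d hk h1 h2 h3 h4
    by_cases hd : d ∈ C
    · exact ⟨d, hd, .single h2⟩
    obtain ⟨e, h5, h6, h7⟩ := exists_closer h3 hd
    have h8 : ¬ G.skel.Adj v e := fun ha => by
      have := distTo_le_of_d (hG.d_trans h1 h5 ha) h6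
      omega
    have h9 := hu v d e h1 h5 h8 (fun h => hG.not_d_symm h1 (h ▸ h5)) h2
    obtain ⟨c, hc, h10⟩ := ih d e (by omega) h5 h9 h6 h7
    exact ⟨c, hc, .head h2 h10⟩

/-! ### Orienting the skeleton by a partial order -/

/-- `H` is obtained from the skeleton of the ancestral graph `G` by orienting edges according to
the partial order `σ`, and the elements below `i` or `j` separate `i` from `j` in `G` whenever `i`
and `j` are the endpoints of an unshielded triple or of a discriminating path of `G`. -/
structure Oriented (G H : MixedGraph V) (σ : PartialOrder V) : Prop where
  ancestral : G.IsAncestral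
  ancestral' : H.IsAncestral
  skel_eq : H.skel = G.skel
  d_iff : ∀ u v, G.skel.Adj u v → (H.D u v ↔ σ.le u v)
  sep : ∀ p l m w, G.Seg p l m w → ¬ G.MConn (preSep σ (p l) w) (p l) w

namespace Oriented

variable {σ : PartialOrder V}

theorem le_of_anc (h : G.Oriented H σ) {u v : V} (huv : H.Anc u v) : σ.le u v := by
  induction huv with
  | refl => exact σ.le_refl _
  | tail _ hd ih =>
    have : G.skel.Adj _ _ := h.skel_eq ▸ (show H.skel.Adj _ _ from Or.inl hd)
    exact σ.le_trans _ _ _ ih ((h.d_iff _ _ this).1 hd)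

theorem into_of_not_le (h : G.Oriented H σ) {u v : V} (ha : G.skel.Adj u v)
    (hle : ¬ σ.le v u) : H.Into u v :=
  IsAncestral.into_of_not_d (h.skel_eq ▸ ha) fun hd => hle ((h.d_iff _ _ ha.symm).1 hd)

theorem le_of_lt (h : G.Oriented H σ) (hs : G.Seg p l m w) {y : ℕ} (hy : l ≤ y) (hym : y < m) :
    σ.le (p y) (p l) ∨ σ.le (p y) w := by
  rcases hy.eq_or_lt with rfl | hy
  · exact Or.inl (σ.le_refl _)
  · exact (hs.mem h.ancestral (h.sep _ _ _ _ hs) hy hym).1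

/-- A collider of `G` at the end of an unshielded triple or a discriminating path is a collider
of `H`. -/
theorem collider (h : G.Oriented H σ) (hs : G.Seg p l m w)
    (hc : G.Collider (p (m - 1)) (p m) w) : H.Collider (p (m - 1)) (p m) w := by
  have hl := hs.lt
  have h1 : p m ∉ preSep σ (p l) w := fun h1 =>
    (hs.mem_iff h.ancestral (h.sep _ _ _ _ hs)).1 h1 hc
  have h2 : ¬ (σ.le (p m) (p l) ∨ σ.le (p m) w) := fun h2 => h1 ⟨h2, by
    rintro (h3 | h3)
    · exact hs.inj l m le_rfl hl le_rfl h3.symm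
    · exact hs.adj_last.ne h3⟩
  refine ⟨h.into_of_not_le hc.1.adj fun h3 => ?_, h.into_of_not_le hc.2.adj fun h3 => ?_⟩
  · exact h2 ((h.le_of_lt hs (y := m - 1) (by omega) (by omega)).imp
      (σ.le_trans _ _ _ h3) (σ.le_trans _ _ _ h3))
  · exact h2 (Or.inr h3)

theorem le_of_not_collider (h : G.Oriented H σ) (hs : G.Seg p l m w)
    (hc : ¬ G.Collider (p (m - 1)) (p m) w) : σ.le (p m) (p l) ∨ σ.le (p m) w :=
  ((hs.mem_iff h.ancestral (h.sep _ _ _ _ hs)).2 hc).1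

theorem le_of_d (h : G.Oriented H σ) (hs : G.Seg p l m w) (hd : G.D (p m) w) :
    σ.le (p m) (p l) ∨ σ.le (p m) w :=
  h.le_of_not_collider hs fun hc => h.ancestral.not_into_of_d hd hc.2

/-- Colliders of a minimal connecting walk of `G` are colliders in `H`. -/
theorem collider_of_minConn (h : G.Oriented H σ) (hp : G.MinConn C n p) (hm : 0 < m)
    (hmn : m < n) (hc : G.Collider (p (m - 1)) (p m) (p (m + 1))) :
    H.Collider (p (m - 1)) (p m) (p (m + 1)) := by
  rcases hp.seg_or_seg h.ancestral hm hmn with ⟨l, hs⟩ | ⟨l, hs⟩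
  · exact h.collider hs hc
  · have h1 := h.collider hs
    simp only [show n - (n - m) = m by omega, show n - (n - m - 1) = m + 1 by omega] at h1
    exact (h1 hc.symm).symm

theorem exists_anc (h : G.Oriented H σ) {v d : V} (hd : G.D v d) (hd' : H.D v d)
    (hC : ∃ c ∈ C, G.Anc d c) (hlt : G.distTo C d + 1 = G.distTo C v) :
    ∃ c ∈ C, H.Anc v c := by
  refine exists_anc_of_closer h.ancestral (fun u k w h1 h2 h3 h4 h5 => ?_) hd hd' hC hlt
  have h6 := h.le_of_d (seg_of_unshielded (Or.inl h1) (Or.inl h2) h3 h4) (by simpa using h2)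
  simp only [one_ne_zero, if_false, if_true] at h6
  rcases h6 with h6 | h6
  · have h7 := (h.d_iff _ _ (Or.inl h1)).1 h5
    exact absurd (σ.le_antisymm _ _ h7 h6 ▸ h1) (G.D_irrefl _)
  · exact (h.d_iff _ _ (Or.inl h2)).2 h6

/-- Let the order `τ` extend `σ` and relate the same pairs of adjacent vertices. Then the set of
all elements below `y` separates `y` from each element below `y` that is not adjacent to it.

On a minimal connecting walk some vertex is not below `y`. Take a `σ`-maximal one: it is a collider
in `H`, but neither a non-collider of `G` nor a collider of `G` is possible there. -/
theorem not_mConn_of_le (h : G.Oriented H σ) {τ : PartialOrder V}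
    (hle : ∀ u v, σ.le u v → τ.le u v)
    (hadj : ∀ u v, G.skel.Adj u v → τ.le u v → σ.le u v) {x y : V} (hxy : x ≠ y)
    (hτ : τ.le x y) (ha : ¬ G.skel.Adj x y) : ¬ G.MConn (preSep τ x y) x y := by
  intro hconn
  obtain ⟨n, p, rfl, rfl, hp⟩ := hconn.exists_minConn hxy
  have hn : 2 ≤ n := by
    by_contra hn
    rcases (show n = 0 ∨ n = 1 by omega) with rfl | rfl
    · exact hxy rfl
    · exact ha (hp.conn.adj 0 one_pos)
  have hC : ∀ c ∈ preSep τ (p 0) (p n), τ.le c (p n) := fun c hc =>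
    hc.1.elim (fun h => τ.le_trans _ _ _ h hτ) id
  have hlast : ¬ τ.le (p (n - 1)) (p n) := by
    intro h1
    have a1 := hp.conn.adj (n - 1) (by omega)
    have o1 := hp.conn.isOpen (n - 2) (by omega)
    rw [show n - 1 + 1 = n by omega] at a1
    rw [show n - 2 + 1 = n - 1 by omega, show n - 2 + 2 = n by omega] at o1
    have h2 : p (n - 1) ∈ preSep τ (p 0) (p n) := by
      refine ⟨Or.inr h1, ?_⟩
      rintro (h2 | h2)
      · exact hp.inj h.ancestral (s := 0) (t := n - 1) (by omega) (by omega) h2.symm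
      · exact a1.ne h2
    have h3 : G.Collider (p (n - 2)) (p (n - 1)) (p n) := by
      by_contra h3
      exact o1.2 h3 h2
    have h4 := h.collider_of_minConn hp (m := n - 1) (by omega) (by omega)
    rw [show n - 1 - 1 = n - 2 by omega, show n - 1 + 1 = n by omega] at h4
    exact h.ancestral'.not_into_of_d ((h.d_iff _ _ a1).2 (hadj _ _ a1 h1)) (h4 h3).2
  classical
  obtain ⟨m, hm, hmax⟩ := @Finset.exists_maximalFor _ _ σ.toLE ⟨σ.le_trans⟩ p
    ((Finset.range (n + 1)).filter fun m => ¬ τ.le (p m) (p n))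
    ⟨n - 1, Finset.mem_filter.2 ⟨Finset.mem_range.2 (by omega), hlast⟩⟩
  obtain ⟨hmn, hmτ⟩ := Finset.mem_filter.1 hm
  rw [Finset.mem_range] at hmn
  have hm0 : 0 < m := Nat.pos_of_ne_zero fun h0 => hmτ (h0 ▸ hτ)
  have hmn : m < n := lt_of_le_of_ne (by omega) fun h0 => hmτ (h0 ▸ τ.le_refl _)
  have hmax' : ∀ k ≤ n, k ≠ m → ¬ σ.le (p m) (p k) := by
    intro k hk hkm h1
    have h2 : ¬ τ.le (p k) (p n) := fun h2 => hmτ (τ.le_trans _ _ _ (hle _ _ h1) h2)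
    have h3 := hmax (Finset.mem_filter.2 ⟨Finset.mem_range.2 (by omega), h2⟩) h1
    have h4 := σ.le_antisymm _ _ h1 h3
    rcases lt_or_gt_of_ne hkm with h5 | h5
    · exact hp.inj h.ancestral h5 hmn.le h4.symm
    · exact hp.inj h.ancestral h5 hk h4
  have ho := hp.conn.isOpen (m - 1) (by omega)
  rw [show m - 1 + 1 = m by omega, show m - 1 + 2 = m + 1 by omega] at ho
  by_cases hc : G.Collider (p (m - 1)) (p m) (p (m + 1))
  · have hmC : p m ∉ preSep τ (p 0) (p n) := fun h1 => hmτ (hC _ h1)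
    obtain ⟨d, hd, hd', hlt⟩ := exists_closer (ho.1 hc) hmC
    have h1 : σ.le (p m) d := by
      rcases hp.seg_or_seg_of_closer h.ancestral hm0 hmn hc hd hd' (by omega) with
        ⟨l, hs⟩ | ⟨l, hs⟩
      · have := hs.lt
        exact (h.le_of_d hs hd).resolve_left (hmax' l (by omega) (by omega))
      · have := hs.lt
        have h2 := h.le_of_d hs
        simp only [show n - (n - m) = m by omega] at h2
        exact (h2 hd).resolve_left (hmax' (n - l) (by omega) (by omega))
    obtain ⟨c, hc, hc'⟩ := h.exists_anc hd ((h.d_iff _ _ (Or.inl hd)).2 h1) hd' hlt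
    exact hmτ (τ.le_trans _ _ _ (hle _ _ (h.le_of_anc hc')) (hC c hc))
  · rcases hp.seg_or_seg h.ancestral hm0 hmn with ⟨l, hs⟩ | ⟨l, hs⟩
    · have := hs.lt
      rcases h.le_of_not_collider hs hc with h1 | h1
      · exact hmax' l (by omega) (by omega) h1
      · exact hmax' (m + 1) (by omega) (by omega) h1
    · have := hs.lt
      have h2 := h.le_of_not_collider hs
      simp only [show n - (n - m) = m by omega, show n - (n - m - 1) = m + 1 by omega] at h2
      rcases h2 fun h3 => hc h3.symm with h1 | h1
      · exact hmax' (n - l) (by omega) (by omega) h1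
      · exact hmax' (m - 1) (by omega) (by omega) h1

/-- If `σ` is the ancestral order of `H` and `H` is maximal, then a non-collider of `G` at the end
of an unshielded triple or a discriminating path is a non-collider of `H`: otherwise that path
would be inducing in `H`. -/
theorem not_collider (h : G.Oriented H σ) (hH : H.IsDMAG) (hσ : ∀ u v, σ.le u v → H.Anc u v)
    (hs : G.Seg p l m w)
    (hcoll : ∀ y, l < y → y < m → H.Collider (p (y - 1)) (p y) (p (y + 1)))
    (hc : ¬ G.Collider (p (m - 1)) (p m) w) : ¬ H.Collider (p (m - 1)) (p m) w := by
  intro hc'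
  have hl := hs.lt
  have key := hH.adj_of_inducing (n := m - l + 1) (p := fun x => if x ≤ m - l then p (x + l) else w)
    (by omega) (by simpa using hs.ne) (fun x hx => ?_) (fun x hx => ?_)
  · simp only [Nat.zero_le, if_true, Nat.zero_add, h.skel_eq] at key
    rw [if_neg (by omega)] at key
    exact hs.not_adj key
  · rw [h.skel_eq]
    rcases (show x < m - l ∨ x = m - l by omega) with h1 | rfl
    · simpa [h1.le, Nat.succ_le_of_lt h1, show x + 1 + l = x + l + 1 by omega] using
        hs.adj (x + l) (by omega) (by omega)
    · simpa [Nat.sub_add_cancel hl.le] using hs.adj_last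
  · simp only [Nat.zero_le, if_true, Nat.zero_add, show x ≤ m - l by omega,
      show x + 1 ≤ m - l by omega, show ¬ m - l + 1 ≤ m - l by omega, if_false]
    rcases (show x + 2 ≤ m - l ∨ x + 1 = m - l by omega) with h1 | h1
    · rw [if_pos h1]
      have h2 := hcoll (x + 1 + l) (by omega) (by omega)
      rw [show x + 1 + l - 1 = x + l by omega, show x + 1 + l + 1 = x + 2 + l by omega] at h2
      exact ⟨h2, (h.le_of_lt hs (by omega) (by omega)).imp (hσ _ _) (hσ _ _)⟩
    · rw [if_neg (by omega), show x + l = m - 1 by omega, show x + 1 + l = m by omega]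
      exact ⟨hc', (h.le_of_not_collider hs hc).imp (hσ _ _) (hσ _ _)⟩

/-- If `σ` is the ancestral order of `H` and `H` is maximal, then separation in `H` implies
separation in `G`. -/
theorem mConn (h : G.Oriented H σ) (hH : H.IsDMAG) (hσ : ∀ u v, σ.le u v → H.Anc u v) {a b : V}
    (hab : a ≠ b) (hconn : G.MConn C a b) : H.MConn C a b := by
  obtain ⟨n, p, rfl, rfl, hp⟩ := hconn.exists_minConn hab
  have hcoll : ∀ q, G.MinConn C n q → ∀ l m w, m < n → G.Seg q l m w →
      ∀ y, l < y → y < m → H.Collider (q (y - 1)) (q y) (q (y + 1)) :=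
    fun q hq l m w hm hs y hy hy' =>
      h.collider_of_minConn hq (by omega) (by omega) (hs.coll y hy hy').1
  have hnc : ∀ m, 0 < m → m < n → ¬ G.Collider (p (m - 1)) (p m) (p (m + 1)) →
      ¬ H.Collider (p (m - 1)) (p m) (p (m + 1)) := by
    intro m hm hmn hc
    rcases hp.seg_or_seg h.ancestral hm hmn with ⟨l, hs⟩ | ⟨l, hs⟩
    · exact h.not_collider hH hσ hs (hcoll p hp _ _ _ hmn hs) hc
    · have h1 := h.not_collider hH hσ hs (hcoll _ hp.reverse _ _ _ (by omega) hs)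
      simp only [show n - (n - m) = m by omega, show n - (n - m - 1) = m + 1 by omega] at h1
      exact fun h2 => h1 (fun h3 => hc h3.symm) h2.symm
  refine ⟨n, p, rfl, rfl, fun m hm => h.skel_eq ▸ hp.conn.adj m hm, fun m hm => ?_⟩
  have ho := hp.conn.isOpen m hm
  by_cases hc : G.Collider (p m) (p (m + 1)) (p (m + 2))
  swap
  · exact ⟨fun h1 => absurd h1 (hnc (m + 1) (by omega) (by omega) hc), fun _ => ho.2 hc⟩
  have hc' : H.Collider (p m) (p (m + 1)) (p (m + 2)) :=
    h.collider_of_minConn hp (m := m + 1) (by omega) (by omega) hc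
  refine ⟨fun _ => ?_, fun h1 => absurd hc' h1⟩
  by_cases hC : p (m + 1) ∈ C
  · exact ⟨_, hC, .refl⟩
  obtain ⟨d, hd, hd', hlt⟩ := exists_closer (ho.1 hc) hC
  have ha : H.skel.Adj (p (m + 1)) d := h.skel_eq ▸ (show G.skel.Adj _ _ from Or.inl hd)
  refine h.exists_anc hd (IsAncestral.d_of_not_into ha.symm fun h1 => ?_) hd' hlt
  rcases hp.seg_or_seg_of_closer h.ancestral (m := m + 1) (by omega) (by omega) hc hd hd'
    (by omega) with ⟨l, hs⟩ | ⟨l, hs⟩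
  · exact h.not_collider hH hσ hs (hcoll p hp _ _ _ (by omega) hs)
      (fun h2 => h.ancestral.not_into_of_d hd h2.2) ⟨hc'.1, h1⟩
  · have h2 := h.not_collider hH hσ hs (hcoll _ hp.reverse _ _ _ (by omega) hs)
    simp only [show n - (n - (m + 1)) = m + 1 by omega,
      show n - (n - (m + 1) - 1) = m + 2 by omega] at h2
    exact h2 (fun h3 => h.ancestral.not_into_of_d hd h3.2) ⟨hc'.2, h1⟩

end Oriented

variable {K : MixedGraph V}

/-! ### Graphs with the same skeleton and nested separation relations -/

/-- `G` and the maximal graph `K` have the same skeleton, and separation in `K` implies separation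
in `G`. -/
structure Refines (G K : MixedGraph V) : Prop where
  ancestral : G.IsAncestral
  dmag : K.IsDMAG
  skel_eq : G.skel = K.skel
  mConn : ∀ (C : Set V) (a b : V), a ≠ b → G.MConn C a b → K.MConn C a b

namespace Refines

/-- A discriminating path of `K` whose colliders before `p m` are colliders of `G` decides about
`p m` in the same way in both graphs, as the endpoints have a common separating set. -/
theorem collider_iff (h : G.Refines K) (hs : K.Seg p l m w)
    (hc : ∀ y, l < y → y < m → G.Collider (p (y - 1)) (p y) (p (y + 1))) :
    K.Collider (p (m - 1)) (p m) w ↔ G.Collider (p (m - 1)) (p m) w := by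
  have h1 := h.dmag.not_mConn_preSep hs.ne hs.not_adj
  have h2 := hs.mem_iff h.dmag.ancestral h1
  have h3 := mem_iff_not_collider (G := G) hs.lt (h.skel_eq ▸ hs.adj) (h.skel_eq ▸ hs.adj_last)
    (fun y hy hy' => ⟨hc y hy hy', hs.mem h.dmag.ancestral h1 hy hy'⟩)
    (fun h3 => h1 (h.mConn _ _ _ hs.ne h3))
  exact not_iff_not.1 (h2.symm.trans h3)

theorem d_of_unshielded (h : G.Refines K) {u k v : V} (h1 : K.D u k) (h2 : K.D k v)
    (h3 : ¬ K.skel.Adj u v) (h4 : u ≠ v) (h5 : G.D u k) : G.D k v := by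
  have h6 := h.collider_iff (seg_of_unshielded (Or.inl h1) (Or.inl h2) h3 h4)
    (fun y hy hy' => by omega)
  simp only [Nat.sub_self, if_true, one_ne_zero, if_false] at h6
  have h7 : G.skel.Adj k v := h.skel_eq ▸ (show K.skel.Adj k v from Or.inl h2)
  refine IsAncestral.d_of_not_into h7.symm fun h8 => ?_
  exact h.dmag.ancestral.not_into_of_d h2 (h6.2 ⟨Or.inl h5, h8⟩).2

/-- The `m`-th vertex of the walk `p` of length `n` is bad: an interior vertex
that is a collider in `K` only. -/
def Bad (G K : MixedGraph V) (n : ℕ) (p : ℕ → V) (m : ℕ) : Prop :=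
  0 < m ∧ m < n ∧ K.Collider (p (m - 1)) (p m) (p (m + 1)) ∧
    ¬ G.Collider (p (m - 1)) (p m) (p (m + 1))

/-- A bad vertex is discriminated to its left or to its right, and another bad vertex lies among the
colliders that discriminate it. -/
theorem Bad.exists_interval (h : G.Refines K) (hp : K.MinConn C n p) (hb : Bad G K n p m) :
    (∃ l < m, (∀ y, l < y → y < m → K.D (p y) (p (m + 1)) ∧
      K.Collider (p (y - 1)) (p y) (p (y + 1))) ∧ ∃ y, l < y ∧ y < m ∧ Bad G K n p y) ∨
    ∃ r ≤ n, (∀ y, m < y → y < r → K.D (p y) (p (m - 1)) ∧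
      K.Collider (p (y - 1)) (p y) (p (y + 1))) ∧ ∃ y, m < y ∧ y < r ∧ Bad G K n p y := by
  obtain ⟨hm, hmn, hK, hG⟩ := hb
  rcases hp.seg_or_seg h.dmag.ancestral hm hmn with ⟨l, hs⟩ | ⟨l, hs⟩
  · refine Or.inl ⟨l, hs.lt, fun y hy hy' => (hs.coll y hy hy').symm, ?_⟩
    by_contra! hcon
    refine hG ((h.collider_iff hs fun y hy hy' => ?_).1 hK)
    by_contra h1
    exact hcon y hy hy' ⟨by omega, by omega, (hs.coll y hy hy').1, h1⟩
  · have hl := hs.lt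
    have hcoll : ∀ y, m < y → y < n - l → K.D (p y) (p (m - 1)) ∧
        K.Collider (p (y - 1)) (p y) (p (y + 1)) := by
      intro y hy hy'
      have h1 := hs.coll (n - y) (by omega) (by omega)
      simp only [show n - (n - y) = y by omega, show n - (n - y - 1) = y + 1 by omega,
        show n - (n - y + 1) = y - 1 by omega] at h1
      exact ⟨h1.2, h1.1.symm⟩
    refine Or.inr ⟨n - l, by omega, hcoll, ?_⟩
    by_contra! hcon
    have h1 := h.collider_iff hs fun y hy hy' => ?_
    · simp only [show n - (n - m) = m by omega, show n - (n - m - 1) = m + 1 by omega] at h1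
      exact hG (h1.1 hK.symm).symm
    · by_contra h1
      refine hcon (n - y) (by omega) (by omega)
        ⟨by omega, by omega, (hcoll (n - y) (by omega) (by omega)).2, fun h2 => h1 ?_⟩
      rw [show n - y - 1 = n - (y + 1) by omega, show n - y + 1 = n - (y - 1) by omega] at h2
      exact h2.symm

/-- On a minimal connecting walk of `K` it is impossible that the colliders from `p y` to `p m` are
parents of `p (y - 1)` except for `p y`, and parents of `p (m + 1)` except for `p m`: this part of
the walk would be inducing, and an edge `p (y - 1) ↔ p (m + 1)` would be a shortcut. -/
theorem not_crossing (h : K.IsDMAG) (hp : K.MinConn C n p) {y : ℕ} (hy : 0 < y) (hym : y < m)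
    (hmn : m < n) (hc : ∀ z, y ≤ z → z ≤ m → K.Collider (p (z - 1)) (p z) (p (z + 1)))
    (hl : ∀ z, y < z → z ≤ m → K.D (p z) (p (y - 1)))
    (hr : ∀ z, y ≤ z → z < m → K.D (p z) (p (m + 1))) : False := by
  have hK := h.ancestral
  have hadj : K.skel.Adj (p (y - 1)) (p (m + 1)) := by
    have key := h.adj_of_inducing (n := m + 2 - y) (p := fun x => p (x + (y - 1))) (by omega)
      (hp.inj hK (by omega) (by omega)) (fun x hx => ?_) (fun x hx => ?_)
    · simpa [show m + 2 - y + (y - 1) = m + 1 by omega] using key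
    · have := hp.conn.adj (x + (y - 1)) (by omega)
      rwa [show x + (y - 1) + 1 = x + 1 + (y - 1) by omega] at this
    · have h1 := hc (x + 1 + (y - 1)) (by omega) (by omega)
      rw [show x + 1 + (y - 1) - 1 = x + (y - 1) by omega,
        show x + 1 + (y - 1) + 1 = x + 2 + (y - 1) by omega] at h1
      refine ⟨h1, ?_⟩
      simp only [Nat.zero_add, show m + 2 - y + (y - 1) = m + 1 by omega]
      rcases (show x + 1 + (y - 1) = y ∨ y < x + 1 + (y - 1) by omega) with h2 | h2
      · rw [h2]
        exact Or.inr (.single (hr y le_rfl hym))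
      · exact Or.inl (.single (hl _ h2 (by omega)))
  have cy := hc y le_rfl hym.le
  have cm := hc m hym.le le_rfl
  have h1 : K.Into (p y) (p (y - 1)) := by
    refine IsAncestral.into_of_not_d cy.1.adj.symm fun h1 => ?_
    have h2 := hc (y + 1) (by omega) (by omega)
    rw [Nat.add_sub_cancel] at h2
    exact hK.not_into_of_transGen (.tail (.single (hl (y + 1) (by omega) (by omega))) h1) h2.1
  have h2 : K.Into (p m) (p (m + 1)) := by
    refine IsAncestral.into_of_not_d cm.2.adj.symm fun h2 => ?_
    have h3 := hc (m - 1) (by omega) (by omega)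
    rw [Nat.sub_add_cancel (by omega)] at h3
    exact hK.not_into_of_transGen (.tail (.single (hr (m - 1) (by omega) (by omega))) h2) h3.2
  have h3 : K.Into (p (y - 1)) (p (m + 1)) := hK.into_trans cy.1 (hr y le_rfl hym) hadj
  have h4 : K.Into (p (m + 1)) (p (y - 1)) := hK.into_trans cm.2 (hl m hym le_rfl) hadj.symm
  refine hp.not_shortcut (s := y - 1) (t := m + 1) (by omega) (by omega) hadj (fun h5 => ?_)
    fun h5 => ?_
  · have ho := hp.conn.isOpen (y - 2) (by omega)
    rw [show y - 2 + 1 = y - 1 by omega, show y - 2 + 2 = y by omega] at ho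
    rw [show y - 1 - 1 = y - 2 by omega]
    exact ho.congr Iff.rfl (iff_of_true h1 h4)
  · exact (hp.conn.isOpen m (by omega)).congr (iff_of_true h2 h3) Iff.rfl

/-- All colliders of a minimal connecting walk of `K` are colliders of `G`. -/
theorem not_bad (h : G.Refines K) (hp : K.MinConn C n p) (m : ℕ) : ¬ Bad G K n p m := by
  classical
  -- Of two consecutive bad vertices, the left one cannot look to the right while the right one
  -- looks to the left. As the leftmost one looks to the right, so do all of them.
  have key : ∀ m, Bad G K n p m → ∃ r ≤ n, (∀ y, m < y → y < r → K.D (p y) (p (m - 1)) ∧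
      K.Collider (p (y - 1)) (p y) (p (y + 1))) ∧ ∃ y, m < y ∧ y < r ∧ Bad G K n p y := by
    intro m
    induction m using Nat.strong_induction_on with
    | _ m ih =>
      intro hb
      rcases Bad.exists_interval h hp hb with ⟨l, hl, h1, y, hy, hym, hby⟩ | h1
      swap
      · exact h1
      exfalso
      set z := Nat.findGreatest (Bad G K n p) (m - 1) with hz
      have hbz : Bad G K n p z := Nat.findGreatest_spec (by omega : y ≤ m - 1) hby
      have hzm : z ≤ m - 1 := Nat.findGreatest_le _
      have hyz : y ≤ z := Nat.le_findGreatest (by omega) hby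
      have hm := hb.1
      obtain ⟨r, hr, h2, x, hx, hxr, hbx⟩ := ih z (by omega) hbz
      have hmx : m ≤ x := by
        by_contra hmx
        have : x ≤ z := Nat.le_findGreatest (by omega) hbx
        omega
      refine not_crossing h.dmag hp hbz.1 (by omega) hb.2.1 (fun t ht ht' => ?_)
        (fun t ht ht' => (h2 t ht (by omega)).1) (fun t ht ht' => (h1 t (by omega) ht').1)
      rcases ht.eq_or_lt with rfl | ht
      · exact hbz.2.2.1
      · exact (h2 t ht (by omega)).2
  intro hb
  have hb' := Nat.findGreatest_spec (P := Bad G K n p) hb.2.1.le hb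
  obtain ⟨r, hr, _, y, hy, hyr, hby⟩ := key _ hb'
  have : y ≤ Nat.findGreatest (Bad G K n p) n := Nat.le_findGreatest (by omega) hby
  omega

/-- Separation in `G` implies separation in `K`, so that both graphs have the same separations. -/
theorem mConn_symm (h : G.Refines K) {a b : V} (hab : a ≠ b) (hconn : K.MConn C a b) :
    G.MConn C a b := by
  obtain ⟨n, p, rfl, rfl, hp⟩ := hconn.exists_minConn hab
  have hK := h.dmag.ancestral
  have hcoll : ∀ m, 0 < m → m < n → K.Collider (p (m - 1)) (p m) (p (m + 1)) →
      G.Collider (p (m - 1)) (p m) (p (m + 1)) := fun m hm hmn hc => by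
    by_contra h1
    exact h.not_bad hp m ⟨hm, hmn, hc, h1⟩
  have hl : ∀ l m w, m < n → K.Seg p l m w →
      (K.Collider (p (m - 1)) (p m) w ↔ G.Collider (p (m - 1)) (p m) w) :=
    fun l m w hm hs => h.collider_iff hs fun y hy hy' =>
      hcoll y (by omega) (by omega) (hs.coll y hy hy').1
  have hr : ∀ l m w, 0 < m → m < n → K.Seg (fun x => p (n - x)) l (n - m) w →
      (K.Collider (p (m + 1)) (p m) w ↔ G.Collider (p (m + 1)) (p m) w) := by
    intro l m w hm hmn hs
    have h1 := h.collider_iff hs fun y hy hy' => ?_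
    · simpa only [show n - (n - m) = m by omega, show n - (n - m - 1) = m + 1 by omega] using h1
    · have h2 := (hs.coll y hy hy').1.symm
      have h3 := hcoll (n - y) (by omega) (by omega)
      rw [show n - y - 1 = n - (y + 1) by omega, show n - y + 1 = n - (y - 1) by omega] at h3
      exact (h3 h2).symm
  refine ⟨n, p, rfl, rfl, fun m hm => h.skel_eq ▸ hp.conn.adj m hm, fun m hm => ?_⟩
  have ho := hp.conn.isOpen m hm
  have hiff : K.Collider (p m) (p (m + 1)) (p (m + 2)) ↔
      G.Collider (p m) (p (m + 1)) (p (m + 2)) := by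
    rcases hp.seg_or_seg hK (m := m + 1) (by omega) (by omega) with ⟨l, hs⟩ | ⟨l, hs⟩
    · exact hl l _ _ (by omega) hs
    · have h1 := hr l (m + 1) _ (by omega) (by omega) hs
      rwa [collider_comm, collider_comm (G := G)] at h1
  refine ⟨fun hc' => ?_, fun h1 => ho.2 fun h2 => h1 (hiff.1 h2)⟩
  have hc := hiff.2 hc'
  by_cases hC : p (m + 1) ∈ C
  · exact ⟨_, hC, .refl⟩
  obtain ⟨d, hd, hd', hlt⟩ := exists_closer (ho.1 hc) hC
  have ha : G.skel.Adj (p (m + 1)) d := h.skel_eq ▸ (show K.skel.Adj _ _ from Or.inl hd)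
  refine exists_anc_of_closer hK (fun u k w => h.d_of_unshielded) hd
    (IsAncestral.d_of_not_into ha.symm fun h1 => ?_) hd' hlt
  rcases hp.seg_or_seg_of_closer hK (m := m + 1) (by omega) (by omega) hc hd hd'
    (by omega) with ⟨l, hs⟩ | ⟨l, hs⟩
  · exact hK.not_into_of_d hd ((hl l _ _ (by omega) hs).2 ⟨hc'.1, h1⟩).2
  · exact hK.not_into_of_d hd ((hr l (m + 1) _ (by omega) (by omega) hs).2 ⟨hc'.2, h1⟩).2

end Refines

theorem markovEquiv_of_mConn_iff (hG : G.IsAncestral) (hK : K.IsAncestral)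
    (h : ∀ (C : Set V) (a b : V), a ≠ b → (G.MConn C a b ↔ K.MConn C a b)) :
    G.MarkovEquiv K := by
  intro A B C hAB _ _
  have key : ∀ i ∈ A, ∀ j ∈ B, (G.MSep {i} {j} C ↔ K.MSep {i} {j} C) := by
    intro i hi j hj
    have hij : i ≠ j := fun h => Set.disjoint_left.1 hAB hi (h ▸ hj)
    rw [← not_iff_not, not_mSep_iff hG hij, not_mSep_iff hK hij]
    exact h C i j hij
  have hsingle : ∀ L : MixedGraph V, L.MSep A B C ↔ ∀ i ∈ A, ∀ j ∈ B, L.MSep {i} {j} C := by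
    intro L
    simp [MSep]
  rw [hsingle, hsingle]
  exact forall₂_congr fun i hi => forall₂_congr fun j hj => key i hi j hj

/-! ### Counting edges -/

theorem ncard_edgeSet_le_numEdges [Finite V] (G : MixedGraph V) :
    G.skel.edgeSet.ncard ≤ G.numEdges := by
  have h : G.skel.edgeSet ⊆ (fun p : V × V => s(p.1, p.2)) '' {p | G.D p.1 p.2} ∪
      {e : Sym2 V | ∃ i j, e = s(i, j) ∧ G.B i j} := by
    intro e
    induction e using Sym2.ind with
    | _ i j =>
      rintro (h | h | h)
      · exact Or.inl ⟨(i, j), h, rfl⟩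
      · exact Or.inl ⟨(j, i), h, Sym2.eq_swap⟩
      · exact Or.inr ⟨i, j, rfl, h⟩
  calc _ ≤ _ := Set.ncard_le_ncard h (Set.toFinite _)
    _ ≤ _ := Set.ncard_union_le _ _
    _ ≤ _ := Nat.add_le_add_right (Set.ncard_image_le (Set.toFinite _)) _

theorem IsAncestral.numEdges_le [Finite V] (hG : G.IsAncestral) :
    G.numEdges ≤ G.skel.edgeSet.ncard := by
  have hinj : Set.InjOn (fun p : V × V => s(p.1, p.2)) {p | G.D p.1 p.2} := by
    rintro ⟨i, j⟩ h ⟨i', j'⟩ h' heq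
    rcases Sym2.eq_iff.1 heq with ⟨h1, h2⟩ | ⟨h1, h2⟩
    · exact Prod.ext h1 h2
    · simp only at h1 h2
      subst h1 h2
      exact absurd h' (hG.not_d_symm h)
  rw [numEdges, ← hinj.ncard_image, ← Set.ncard_union_eq _ (Set.toFinite _)
    (Set.toFinite _)]
  · refine Set.ncard_le_ncard ?_ (Set.toFinite _)
    rintro e (⟨⟨i, j⟩, h, rfl⟩ | ⟨i, j, rfl, h⟩)
    · exact Or.inl h
    · exact Or.inr (Or.inr h)
  · rw [Set.disjoint_left]
    rintro e ⟨⟨i, j⟩, h, rfl⟩ ⟨i', j', heq, h'⟩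
    rcases Sym2.eq_iff.1 heq with ⟨h1, h2⟩ | ⟨h1, h2⟩
    · simp only at h1 h2
      subst h1 h2
      exact hG.no_dirPath _ _ h' (.single h)
    · simp only at h1 h2
      subst h1 h2
      exact hG.no_dirPath _ _ (G.B_symm _ _ h') (.single h)

/-- An ancestral graph that contains all edges of `G` and has no further adjacencies is `G`. -/
theorem IsAncestral.eq_of_subset (hK : K.IsAncestral) (hD : ∀ i j, G.D i j → K.D i j)
    (hB : ∀ i j, G.B i j → K.B i j) (hs : K.skel ≤ G.skel) : K = G := by
  ext i j
  · refine ⟨fun h => ?_, hD i j⟩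
    rcases hs (show K.skel.Adj i j from Or.inl h) with h1 | h1 | h1
    · exact h1
    · exact absurd (hD _ _ h1) (hK.not_d_symm h)
    · exact absurd (.single h) (hK.no_dirPath _ _ (hB _ _ h1))
  · refine ⟨fun h => ?_, hB i j⟩
    rcases hs (show K.skel.Adj i j from Or.inr (Or.inr h)) with h1 | h1 | h1
    · exact absurd (.single (hD _ _ h1)) (hK.no_dirPath _ _ h)
    · exact absurd (.single (hD _ _ h1)) (hK.no_dirPath _ _ (K.B_symm _ _ h))
    · exact h1

end MixedGraph

/-! ### The graphs of a partial order -/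

theorem notMem_preSep_left {V : Type*} {σ : PartialOrder V} {i j : V} : i ∉ preSep σ i j :=
  fun h => h.2 (Or.inl rfl)

theorem notMem_preSep_right {V : Type*} {σ : PartialOrder V} {i j : V} : j ∉ preSep σ i j :=
  fun h => h.2 (Or.inr rfl)

section Distribution

open MeasureTheory MixedGraph

variable {V : Type*} [Finite V] {𝓧 : V → Type*} [∀ v, MeasurableSpace (𝓧 v)]
  [∀ v, StandardBorelSpace (𝓧 v)] {P : Measure (∀ v, 𝓧 v)} [IsProbabilityMeasure P]
  {G : MixedGraph V}

theorem AG_adj_iff {σ : PartialOrder V} {i j : V} (hij : i ≠ j) :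
    (AG P σ).skel.Adj i j ↔ ¬ CI P {i} {j} (preSep σ i j) := by
  constructor
  · rintro (h | h | h)
    · exact h.2.2
    · exact fun hc => h.2.2 (preSep_comm σ i j ▸ hc.symm)
    · exact h.2.2
  · intro h
    by_cases h1 : σ.le i j
    · exact Or.inl ⟨hij, h1, h⟩
    by_cases h2 : σ.le j i
    · exact Or.inr (Or.inl ⟨hij.symm, h2, fun hc => h (preSep_comm σ i j ▸ hc.symm)⟩)
    · exact Or.inr (Or.inr ⟨h1, h2, h⟩)

theorem AG_d_iff {σ : PartialOrder V} {i j : V} (h : (AG P σ).skel.Adj i j) :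
    (AG P σ).D i j ↔ σ.le i j :=
  ⟨fun h1 => h1.2.1, fun h1 => ⟨h.ne, h1, (AG_adj_iff h.ne).1 h⟩⟩

theorem RestrictedFaithful.skel_le (hP : RestrictedFaithful P G) (σ : PartialOrder V) :
    G.skel ≤ (AG P σ).skel := fun i j h =>
  (AG_adj_iff h.ne).2 (hP.adjacency i j h _ notMem_preSep_left notMem_preSep_right)

theorem RestrictedFaithful.ci_of_not_mConn (hP : RestrictedFaithful P G) (hG : G.IsAncestral)
    {σ : PartialOrder V} {i j : V} (hij : i ≠ j) (h : ¬ G.MConn (preSep σ i j) i j) :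
    CI P {i} {j} (preSep σ i j) := by
  refine hP.markov _ _ _ (by simpa using hij) (by simpa using notMem_preSep_left)
    (by simpa using notMem_preSep_right) ?_
  by_contra h1
  exact h ((not_mSep_iff hG hij).1 h1)

/-- The ancestral order of a maximal ancestral graph `G` to which `P` is restricted-faithful yields
the graph `G` itself. -/
theorem RestrictedFaithful.AG_po (hP : RestrictedFaithful P G) (hG : G.IsDMAG) :
    AG P (G.po hG.ancestral) = G := by
  have hs : (AG P (G.po hG.ancestral)).skel ≤ G.skel := by
    intro i j h
    by_contra h1
    exact (AG_adj_iff h.ne).1 h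
      (hP.ci_of_not_mConn hG.ancestral h.ne (hG.not_mConn_preSep h.ne h1))
  refine (AG_isAncestral P _).eq_of_subset (fun i j h => ?_) (fun i j h => ?_) hs
  · exact (AG_d_iff (hP.skel_le _ (Or.inl h))).2 (.single h)
  · exact ⟨hG.ancestral.not_anc_of_into (Or.inr (G.B_symm _ _ h)),
      hG.ancestral.not_anc_of_into (Or.inr h),
      (AG_adj_iff (show G.skel.Adj i j from Or.inr (Or.inr h)).ne).1
        (hP.skel_le _ (Or.inr (Or.inr h)))⟩

theorem RestrictedFaithful.isPosetGraph (hP : RestrictedFaithful P G) (hG : G.IsDMAG) :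
    IsPosetGraph P (G.po hG.ancestral) G := by
  have h1 := hP.AG_po hG
  have h2 : (AG P (G.po hG.ancestral)).po (AG_isAncestral P _) = G.po hG.ancestral := by
    ext i j
    change (AG P (G.po hG.ancestral)).Anc i j ↔ G.Anc i j
    rw [h1]
  rw [IsPosetGraph, h2, h1]
  exact ⟨hG, fun _ _ => id, fun _ _ => id, fun _ _ _ _ _ _ => Iff.rfl⟩

/-- Restricted faithfulness turns conditional independence of the endpoints of an unshielded triple
or a discriminating path into separation. -/
theorem RestrictedFaithful.not_mConn_of_seg (hP : RestrictedFaithful P G) (hG : G.IsAncestral)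
    {p : ℕ → V} {l m : ℕ} {w : V} (hs : G.Seg p l m w) {S : Set V} (hl : p l ∉ S) (hw : w ∉ S)
    (hc : CI P {p l} {w} S) : ¬ G.MConn S (p l) w := by
  rw [← not_mSep_iff hG hs.ne]
  intro hsep
  have hlt := hs.lt
  rcases (show m = l + 1 ∨ l + 1 < m by omega) with rfl | hlm
  · exact hP.orientation (p l) (p (l + 1)) w hs.ne (hs.adj l le_rfl hlt) hs.adj_last S hl hw hsep hc
  have hmw : ∀ y, l ≤ y → y ≤ m → p y ≠ w := by
    intro y hy hym
    rcases hym.eq_or_lt with rfl | hym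
    · exact hs.adj_last.ne
    rcases hy.eq_or_lt with rfl | hy
    · exact hs.ne
    · exact fun h => G.D_irrefl w (h ▸ (hs.coll y hy hym).2)
  obtain ⟨q, hq, hq', hq''⟩ := skel_path_of_adj (G := G) (n := m - l + 1)
    (p := fun x => if x ≤ m - l then p (x + l) else w) (fun x hx => by
      rcases (show x < m - l ∨ x = m - l by omega) with h1 | rfl
      · simpa [h1.le, Nat.succ_le_of_lt h1, show x + 1 + l = x + l + 1 by omega] using
          hs.adj (x + l) (by omega) (by omega)
      · simpa [Nat.sub_add_cancel hlt.le] using hs.adj_last)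
    (fun s t hst ht => by
      rw [if_pos (by omega)]
      split_ifs with h1
      · exact hs.inj _ _ (by omega) (by omega) (by omega)
      · exact hmw _ (by omega) (by omega))
  have e0 : (if 0 ≤ m - l then p (0 + l) else w) = p l := by simp
  have e1 : (if m - l + 1 ≤ m - l then p (m - l + 1 + l) else w) = w := by simp
  have hd : G.Discriminating q := by
    refine ⟨hq, ?_, by omega, fun x hx => ?_⟩
    · rw [e0, e1]
      exact hs.not_adj
    · rw [hq'' x (by omega), hq'' (x + 1) (by omega), hq'' (x + 2) (by omega)]
      have h1 := hs.coll (x + 1 + l) (by omega) (by omega)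
      rw [show x + 1 + l - 1 = x + l by omega, show x + 1 + l + 1 = x + 2 + l by omega] at h1
      simp only [show x ≤ m - l by omega, show x + 1 ≤ m - l by omega,
        show x + 2 ≤ m - l by omega, show ¬ m - l + 1 ≤ m - l by omega, if_true, if_false]
      exact h1
  have key := hP.discriminating _ _ q hd S
  beta_reduce at key
  rw [e0, e1] at key
  exact key hl hw hsep hc

end Distribution

theorem theorem2 {V : Type*} [Finite V] {𝓧 : V → Type*} [∀ v, MeasurableSpace (𝓧 v)]
    [∀ v, StandardBorelSpace (𝓧 v)]
    (P : MeasureTheory.Measure (∀ v, 𝓧 v)) [MeasureTheory.IsProbabilityMeasure P]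
    (Gstar : MixedGraph V) (hGstar : Gstar.IsDMAG) (hP : RestrictedFaithful P Gstar)
    (τ : PartialOrder V) (Gτ : MixedGraph V) (hGτ : IsPosetGraph P τ Gτ)
    (hmin : ∀ (π : PartialOrder V) (Gπ : MixedGraph V), IsPosetGraph P π Gπ →
      Gτ.numEdges ≤ Gπ.numEdges) :
    Gτ.MarkovEquiv Gstar := by
  have hG := hGstar.ancestral
  set σ := (AG P τ).po (AG_isAncestral P τ) with hσdef
  have hsub : (AG P σ).skel ≤ Gτ.skel := fun i j h =>
    h.imp (hGτ.directed_subset i j) (Or.imp (hGτ.directed_subset j i) (hGτ.bidirected_subset i j))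
  have hskel : Gτ.skel = Gstar.skel := by
    have h1 : Gstar.skel.edgeSet ⊆ Gτ.skel.edgeSet :=
      SimpleGraph.edgeSet_mono ((hP.skel_le σ).trans hsub)
    have h2 := hmin _ _ (hP.isPosetGraph hGstar)
    have h3 := Set.eq_of_subset_of_ncard_le h1 ((Gτ.ncard_edgeSet_le_numEdges).trans
      (h2.trans hG.numEdges_le)) (Set.toFinite _)
    exact (SimpleGraph.edgeSet_injective h3).symm
  have hτ : Gτ = AG P σ := hGτ.dmag.ancestral.eq_of_subset hGτ.directed_subset
    hGτ.bidirected_subset (hskel.le.trans (hP.skel_le σ))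
  have hor : Gstar.Oriented Gτ σ := by
    refine ⟨hG, hGτ.dmag.ancestral, hskel, fun u v h => ?_, fun p l m w hs => ?_⟩
    · rw [← hskel] at h
      subst hτ
      exact AG_d_iff h
    · refine hP.not_mConn_of_seg hG hs notMem_preSep_left notMem_preSep_right ?_
      by_contra h1
      have h2 := (AG_adj_iff hs.ne).2 h1
      rw [← hτ, hskel] at h2
      exact hs.not_adj h2
  -- No arrow of `AG P τ` joins vertices that are not adjacent in `Gτ`, so that `σ` is the ancestral
  -- order of `Gτ`.
  have hσ : ∀ u v, σ.le u v → Gτ.Anc u v := by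
    have hle : ∀ u v, σ.le u v → τ.le u v := by
      intro u v h
      rcases Relation.reflTransGen_iff_eq_or_transGen.1 h with h1 | h1
      · exact h1 ▸ τ.le_refl _
      · exact (AG_transGen P τ h1).1
    have hadj : ∀ u v, Gstar.skel.Adj u v → τ.le u v → σ.le u v := fun u v h h1 =>
      Relation.ReflTransGen.single ((AG_d_iff (hP.skel_le τ h)).2 h1)
    intro u v h
    refine Relation.ReflTransGen.mono (r := (AG P τ).D) (fun x y hxy => ?_) u v h
    by_cases h1 : Gstar.skel.Adj x y
    · exact (hor.d_iff x y h1).2 (Relation.ReflTransGen.single hxy)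
    · exact absurd (hP.ci_of_not_mConn hG hxy.1 (hor.not_mConn_of_le hle hadj hxy.1 hxy.2.1 h1))
        hxy.2.2
  have hconn : ∀ (C : Set V) (a b : V), a ≠ b → Gstar.MConn C a b → Gτ.MConn C a b :=
    fun C a b hab => hor.mConn hGτ.dmag hσ hab
  have href : Gstar.Refines Gτ := ⟨hG, hGτ.dmag, hskel.symm, hconn⟩
  exact MixedGraph.markovEquiv_of_mConn_iff hGτ.dmag.ancestral hG fun C a b hab =>
    ⟨href.mConn_symm hab, hconn C a b hab⟩
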